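/- All pentagons are simple (not necessarily convex) pentagons of area 1 in the Euclidean plane; let $a_1,\dots,a_5$ be the interior angles. We say that the angle $a_j$ tiles if there are nonnegative integers $m_1,\dots,m_5$ with $m_j\ge 1$ and $\sum_i m_i a_i = 360^\circ$, and that $a_j$ can tile a degree-four vertex if the $m_i$ can be chosen so that in addition $\sum_i m_i = 4$. Among all unit-area pentagons all five of whose angles tile, with at least one angle that can tile a degree-four vertex, there is one of least perimeter. A pentagon is such a perimeter minimizer if and only if it is a unit-area pentagon that is circumscribed about a circle and whose angles are, in some cyclic order, one angle of $90^\circ$, three angles of $108^\circ$ and one angle of $126^\circ$. The least perimeter is approximately $3.8414$ (correct to four decimal places). -/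

import Mathlib

namespace PentagonTiling

open scoped Affine ComplexConjugate

/-- A pentagon in the Euclidean plane `ℂ`, given by its vertices in cyclic order, is simple if two
consecutive edges meet only in their common vertex and two nonconsecutive edges are disjoint.
(In particular the five vertices are distinct. Nonconvex pentagons are allowed.) -/
structure IsSimple (P : Polygon ℂ 5) : Prop where
  consecutive : ∀ i : Fin 5, P.edgeSet ℝ i ∩ P.edgeSet ℝ (i + 1) = {P (i + 1)}
  nonconsecutive : ∀ i j : Fin 5, j ≠ i → j ≠ i + 1 → i ≠ j + 1 →
    Disjoint (P.edgeSet ℝ i) (P.edgeSet ℝ j)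

/-- The signed area of a closed pentagon (shoelace formula). For a simple pentagon it is the
enclosed area if the vertices are labelled counterclockwise, and minus the enclosed area if they
are labelled clockwise. -/
noncomputable def signedArea (P : Polygon ℂ 5) : ℝ :=
  (∑ i : Fin 5, (conj (P i) * P (i + 1)).im) / 2

/-- The pentagon is simple, its vertices are labelled counterclockwise, and it has unit area. -/
structure IsUnitPentagon (P : Polygon ℂ 5) : Prop where
  simple : IsSimple P
  area : signedArea P = 1

/-- The perimeter. -/
noncomputable def perimeter (P : Polygon ℂ 5) : ℝ :=
  ∑ i : Fin 5, dist (P i) (P (i + 1))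

/-- The interior angle at the `i`-th vertex, in `[0, 2π)`, of a simple pentagon labelled
counterclockwise: the angle of the counterclockwise rotation that takes the direction of the
outgoing edge to the direction of the incoming edge reversed. It exceeds `π` at a reflex vertex. -/
noncomputable def interiorAngle (P : Polygon ℂ 5) (i : Fin 5) : ℝ :=
  toIcoMod Real.two_pi_pos 0 (Complex.arg ((P (i - 1) - P i) / (P (i + 1) - P i)))

/-- The `j`-th angle tiles: angles from the list `a`, repetitions allowed and `a j` among them,
sum to `2π`. Here `m i` is the number of times that `a i` is used. -/
def AngleTiles (a : Fin 5 → ℝ) (j : Fin 5) : Prop :=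
  ∃ m : Fin 5 → ℕ, 0 < m j ∧ ∑ i, (m i : ℝ) * a i = 2 * Real.pi

/-- The `j`-th angle can tile a vertex of degree four: exactly four angles from the list `a`,
repetitions allowed and `a j` among them, sum to `2π`. -/
def AngleTilesDegreeFour (a : Fin 5 → ℝ) (j : Fin 5) : Prop :=
  ∃ m : Fin 5 → ℕ, 0 < m j ∧ ∑ i, m i = 4 ∧ ∑ i, (m i : ℝ) * a i = 2 * Real.pi

/-- The pentagon is circumscribed about a circle: each of its edges is tangent to one common circle,
at a point of that edge. -/
def IsCircumscribed (P : Polygon ℂ 5) : Prop :=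
  ∃ s : EuclideanGeometry.Sphere ℂ, 0 < s.radius ∧
    ∀ i : Fin 5, ∃ t ∈ P.edgeSet ℝ i, s.IsTangentAt t line[ℝ, P i, P (i + 1)]

/-- The competitors: unit-area pentagons all five of whose angles tile, at least one of them being
able to tile a vertex of degree four. -/
structure IsCompetitor (P : Polygon ℂ 5) : Prop extends IsUnitPentagon P where
  tiles : ∀ j, AngleTiles (interiorAngle P) j
  tiles_four : ∃ j, AngleTilesDegreeFour (interiorAngle P) j

/-- A competitor of least perimeter. -/
structure IsPerimeterMinimizer (P : Polygon ℂ 5) : Prop extends IsCompetitor P where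
  le_perimeter : ∀ Q : Polygon ℂ 5, IsCompetitor Q → perimeter P ≤ perimeter Q

end PentagonTiling

/-!
At a vertex that is not strictly convex the pentagon can be cut down to a quadrilateral of at least
the same area and at most the same perimeter, so the perimeter `L` and the area `A` satisfy
`L ^ 2 ≥ 16 A`. For a pentagon convex at every vertex Lhuilier's inequality
`L ^ 2 ≥ 4 A ∑ cot (aᵢ / 2)` holds, with equality for circumscribed pentagons only: subtracting `s`
times the pentagon circumscribed about the unit circle with the same edge directions leaves a closed
pentagon of signed area `A - s L + s ^ 2 ∑ cot (aᵢ / 2)`. For a suitable `s` it degenerates and this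
quadratic polynomial is nonpositive, so its discriminant is nonnegative. It remains to minimize
`∑ cot (aᵢ / 2)` over the admissible angles. As `cot (x / 2)` is strictly convex, its tangent lines
show that a sum close to the minimum forces the smallest angle to be `π / 2` and the others to be
larger; then the second smallest angle tiles only if the largest is at least `7π / 10`, and under
this constraint convexity leaves `π / 2, 3π / 5, 3π / 5, 3π / 5, 7π / 10`.
-/

namespace PentagonTiling

open scoped Affine ComplexConjugate Real

/-- The cross product of two plane vectors (`Complex.orientation.areaForm`), in coordinates so that
identities between cross products are polynomial identities. -/
def cross (z w : ℂ) : ℝ := z.re * w.im - z.im * w.re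

/-- Twice the signed area of the triangle `abc`. -/
def orient (a b c : ℂ) : ℝ := cross (b - a) (c - a)

lemma im_conj_mul (z w : ℂ) : (conj z * w).im = cross z w := by
  simp only [cross, Complex.mul_im, Complex.conj_re, Complex.conj_im]
  ring

lemma cross_le_norm_mul_norm (z w : ℂ) : cross z w ≤ ‖z‖ * ‖w‖ := by
  have := Complex.finrank_real_complex_fact
  simpa only [Complex.areaForm, im_conj_mul] using Complex.orientation.areaForm_le z w

lemma cross_ofReal_mul (a b : ℝ) (z w : ℂ) : cross (a * z) (b * w) = a * b * cross z w := by
  simp only [cross, Complex.re_ofReal_mul, Complex.im_ofReal_mul]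
  ring

lemma orient_eq_cross (a b c : ℂ) : orient a b c = cross (b - a) (c - b) := by
  simp only [orient, cross, Complex.sub_re, Complex.sub_im]
  ring

lemma orient_rotate (a b c : ℂ) : orient a b c = orient b c a := by
  simp only [orient, cross, Complex.sub_re, Complex.sub_im]
  ring

lemma sum_fin_five_shift {M : Type*} [AddCommMonoid M] (f : Fin 5 → M) (k : Fin 5) :
    ∑ i, f i = f k + f (k + 1) + f (k + 2) + f (k + 3) + f (k + 4) := by
  rw [← Equiv.sum_comp (Equiv.addLeft k) f, Fin.sum_univ_five]
  simp only [Equiv.coe_addLeft, add_zero]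

lemma signedArea_eq (P : Polygon ℂ 5) (k : Fin 5) :
    signedArea P = (cross (P k) (P (k + 1)) + cross (P (k + 1)) (P (k + 2)) +
      cross (P (k + 2)) (P (k + 3)) + cross (P (k + 3)) (P (k + 4)) +
      cross (P (k + 4)) (P k)) / 2 := by
  rw [signedArea, sum_fin_five_shift _ k]
  simp only [im_conj_mul, add_assoc k, Fin.reduceAdd, add_zero]

lemma perimeter_eq (P : Polygon ℂ 5) (k : Fin 5) :
    perimeter P = dist (P k) (P (k + 1)) + dist (P (k + 1)) (P (k + 2)) +
      dist (P (k + 2)) (P (k + 3)) + dist (P (k + 3)) (P (k + 4)) + dist (P (k + 4)) (P k) := by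
  rw [perimeter, sum_fin_five_shift _ k]
  simp only [add_assoc k, Fin.reduceAdd, add_zero]

lemma quadrilateral_isoperimetric (a b c d : ℂ) :
    8 * (cross a b + cross b c + cross c d + cross d a) ≤
      (dist a b + dist b c + dist c d + dist d a) ^ 2 := by
  have corner (x y z : ℂ) : cross (y - x) (z - y) ≤ dist x y * dist y z := by
    simpa only [dist_eq_norm'] using cross_le_norm_mul_norm (y - x) (z - y)
  have corners : 2 * (cross a b + cross b c + cross c d + cross d a) =
      cross (b - a) (c - b) + cross (c - b) (d - c) + cross (d - c) (a - d) +
        cross (a - d) (b - a) := by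
    simp only [cross, Complex.sub_re, Complex.sub_im]
    ring
  nlinarith [corner a b c, corner b c d, corner c d a, corner d a b,
    sq_nonneg (dist a b + dist c d - dist b c - dist d a)]

-- Cutting off a vertex that is not a left turn increases the area and decreases the perimeter.
lemma sixteen_mul_signedArea_le_perimeter_sq {P : Polygon ℂ 5} {k : Fin 5}
    (hk : orient (P k) (P (k + 1)) (P (k + 2)) ≤ 0) : 16 * signedArea P ≤ perimeter P ^ 2 := by
  have area_cut : 2 * signedArea P = orient (P k) (P (k + 1)) (P (k + 2)) +
      (cross (P k) (P (k + 2)) + cross (P (k + 2)) (P (k + 3)) +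
        cross (P (k + 3)) (P (k + 4)) + cross (P (k + 4)) (P k)) := by
    simp only [signedArea_eq P k, orient, cross, Complex.sub_re, Complex.sub_im]
    ring
  calc 16 * signedArea P ≤ 8 * (cross (P k) (P (k + 2)) + cross (P (k + 2)) (P (k + 3)) +
        cross (P (k + 3)) (P (k + 4)) + cross (P (k + 4)) (P k)) := by linarith
    _ ≤ (dist (P k) (P (k + 2)) + dist (P (k + 2)) (P (k + 3)) +
        dist (P (k + 3)) (P (k + 4)) + dist (P (k + 4)) (P k)) ^ 2 :=
      quadrilateral_isoperimetric ..
    _ ≤ perimeter P ^ 2 := by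
      rw [perimeter_eq P k]
      gcongr
      exact dist_triangle ..

lemma exists_and_add_two_of_forall_or {p : Fin 5 → Prop} (h : ∀ i, p i ∨ p (i + 2)) :
    ∃ i, p i ∧ p (i + 2) := by
  by_contra! hn
  -- `p` would be a proper 2-colouring of the 5-cycle with steps of length 2
  have alternates (i : Fin 5) : p (i + 2) ↔ ¬ p i := ⟨fun h₂ h₀ ↦ hn i h₀ h₂, (h i).resolve_left⟩
  have h₀ := alternates 0
  have h₂ := alternates 2
  have h₄ := alternates 4
  have h₁ := alternates 1
  have h₃ := alternates 3
  simp only [Fin.reduceAdd, zero_add] at h₀ h₂ h₄ h₁ h₃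
  tauto

lemma edgeSet_eq (P : Polygon ℂ 5) (i : Fin 5) :
    P.edgeSet ℝ i = affineSegment ℝ (P i) (P (i + 1)) := by
  simp [Polygon.edgeSet]

lemma mem_edgeSet {P : Polygon ℂ 5} {i : Fin 5} {x : ℂ} :
    x ∈ P.edgeSet ℝ i ↔ ∃ r : ℝ, 0 ≤ r ∧ r ≤ 1 ∧ x = P i + r * (P (i + 1) - P i) := by
  simp only [edgeSet_eq, affineSegment, Set.mem_image, Set.mem_Icc, and_assoc,
    AffineMap.lineMap_apply, vsub_eq_sub, vadd_eq_add, Complex.real_smul, add_comm (P i), eq_comm]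

lemma not_disjoint_affineSegment {a b c d : ℂ} (hc : 0 < orient a b c) (hd : orient a b d ≤ 0)
    (hb : 0 < orient c d b) (ha : orient c d a ≤ 0) :
    ¬ Disjoint (affineSegment ℝ a b) (affineSegment ℝ c d) := by
  set D := orient a b c - orient a b d with hD
  have hD_pos : 0 < D := by linarith
  have hD' : D = orient c d b - orient c d a := by
    simp only [hD, orient, cross, Complex.sub_re, Complex.sub_im]
    ring
  refine Set.not_disjoint_iff.2 ⟨AffineMap.lineMap a b (-orient c d a / D),
    ⟨_, ⟨by bound, by rw [div_le_one hD_pos]; linarith⟩, rfl⟩,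
    ⟨orient a b c / D, ⟨by positivity, by rw [div_le_one hD_pos]; linarith⟩, ?_⟩⟩
  simp only [AffineMap.lineMap_apply, vsub_eq_sub, vadd_eq_add, Complex.real_smul]
  apply Complex.ext <;>
  · simp only [Complex.add_re, Complex.add_im, Complex.re_ofReal_mul, Complex.im_ofReal_mul,
      Complex.sub_re, Complex.sub_im]
    field_simp
    simp only [hD, orient, cross, Complex.sub_re, Complex.sub_im]
    ring

/-- All vertices of the pentagon, traversed in order, are strict left turns. The pentagon need not
be convex: it can be a star. -/
def LocallyConvex (P : Polygon ℂ 5) : Prop :=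
  ∀ i, 0 < orient (P i) (P (i + 1)) (P (i + 2))

lemma IsSimple.orient_pos_or {P : Polygon ℂ 5} (hP : IsSimple P) (hc : LocallyConvex P)
    (i : Fin 5) :
    0 < orient (P i) (P (i + 1)) (P (i + 3)) ∨ 0 < orient (P (i + 2)) (P (i + 3)) (P i) := by
  by_contra! h
  have hturn := hc (i + 1)
  simp only [add_assoc, Fin.reduceAdd] at hturn
  rw [orient_rotate] at hturn
  refine not_disjoint_affineSegment (hc i) h.1 hturn h.2 ?_
  have hdisj := hP.nonconsecutive i (i + 2) (by simp) (by simp) (by simp [add_assoc])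
  rwa [edgeSet_eq, edgeSet_eq, add_assoc] at hdisj

lemma orient_grassmann_plucker (a b c d e : ℂ) :
    orient a b d * orient e a c = orient a b c * orient d e a + orient e a b * orient c d a := by
  simp only [orient, cross, Complex.sub_re, Complex.sub_im]
  ring

lemma lt_orient_or_lt_orient {a b c d e : ℂ} (habc : 0 < orient a b c)
    (heab : 0 < orient e a b) (hcda : 0 < orient c d a) (heac : 0 < orient e a c) :
    orient a b c < orient a b d ∨ orient c d e < orient c d a := by
  by_contra! h
  have hsub : orient e a c - orient d e a = orient c d a - orient c d e := by
    simp only [orient, cross, Complex.sub_re, Complex.sub_im]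
    ring
  have hpl := orient_grassmann_plucker a b c d e
  have : orient a b d * orient e a c ≤ orient a b c * orient e a c := by gcongr; exact h.1
  have : orient a b c * orient e a c ≤ orient a b c * orient d e a := by
    gcongr; linarith [h.2]
  have := mul_pos heab hcda
  linarith

lemma IsSimple.exists_lt_orient {P : Polygon ℂ 5} (hP : IsSimple P) (hc : LocallyConvex P) :
    ∃ i, orient (P i) (P (i + 1)) (P (i + 2)) < orient (P i) (P (i + 1)) (P (i + 3)) := by
  obtain ⟨i, hi, hi'⟩ := exists_and_add_two_of_forall_or
    (p := fun i ↦ 0 < orient (P i) (P (i + 1)) (P (i + 3))) fun i ↦ by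
      simpa only [add_assoc, Fin.reduceAdd, add_zero] using hP.orient_pos_or hc i
  have h₂ := hc (i + 2)
  have h₃ := hc (i + 3)
  simp only [add_assoc, Fin.reduceAdd, add_zero] at hi' h₂ h₃
  rcases lt_orient_or_lt_orient h₃ h₂ hi hi' with h | h
  · exact ⟨i + 3, by simpa only [add_assoc, Fin.reduceAdd, add_zero] using h⟩
  · exact ⟨i, h⟩

/-- The length of the `i`-th edge. -/
noncomputable def edgeLength (P : Polygon ℂ 5) (i : Fin 5) : ℝ := dist (P i) (P (i + 1))

/-- The unit vector along the `i`-th edge. -/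
noncomputable def edgeDir (P : Polygon ℂ 5) (i : Fin 5) : ℂ :=
  (P (i + 1) - P i) / edgeLength P i

lemma toIcoMod_mem_Ioo_zero_pi_iff {θ : ℝ} :
    toIcoMod Real.two_pi_pos 0 θ ∈ Set.Ioo 0 π ↔ 0 < Real.sin θ := by
  have hsin : Real.sin (toIcoMod Real.two_pi_pos 0 θ) = Real.sin θ := by
    simpa only [Real.Angle.sin_coe] using congrArg Real.Angle.sin (Real.Angle.coe_toIcoMod θ 0)
  obtain ⟨h₀, h₁⟩ := toIcoMod_mem_Ico Real.two_pi_pos 0 θ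
  rw [← hsin]
  refine ⟨fun h ↦ Real.sin_pos_of_mem_Ioo h, fun h ↦ ⟨h₀.lt_of_ne ?_, not_le.1 fun hπ ↦ ?_⟩⟩
  · rintro h0
    simp [← h0] at h
  · have := Real.sin_nonneg_of_nonneg_of_le_pi (sub_nonneg.2 hπ) (by linarith)
    rw [Real.sin_sub_pi] at this
    linarith

lemma exp_toIcoMod_arg_mul_I {z : ℂ} (hz : z ≠ 0) :
    Complex.exp (toIcoMod Real.two_pi_pos 0 z.arg * Complex.I) = z / ‖z‖ := by
  have h := congrArg (fun θ : Real.Angle ↦ (θ.toCircle : ℂ)) (Real.Angle.coe_toIcoMod z.arg 0)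
  simp only [Real.Angle.toCircle_coe, Circle.coe_exp] at h
  rw [h, eq_div_iff (by simpa using hz), mul_comm, Complex.norm_mul_exp_arg_mul_I]

lemma interiorAngle_add_one (P : Polygon ℂ 5) (i : Fin 5) :
    interiorAngle P (i + 1) = toIcoMod Real.two_pi_pos 0
      (Complex.arg (-(P (i + 1) - P i) / (P (i + 2) - P (i + 1)))) := by
  rw [interiorAngle, add_sub_cancel_right, neg_sub]
  simp only [add_assoc, Fin.reduceAdd]

lemma interiorAngle_mem_Ioo_iff {P : Polygon ℂ 5} {i : Fin 5} :
    interiorAngle P (i + 1) ∈ Set.Ioo 0 π ↔ 0 < orient (P i) (P (i + 1)) (P (i + 2)) := by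
  have im_div (v w : ℂ) : (-v / w).im = cross v w / Complex.normSq w := by
    simp only [Complex.div_im, cross, Complex.neg_re, Complex.neg_im]
    ring
  rw [interiorAngle_add_one, toIcoMod_mem_Ioo_zero_pi_iff, Complex.sin_arg, im_div,
    orient_eq_cross]
  refine ⟨fun h ↦ ?_, fun h ↦ ?_⟩
  · contrapose! h
    exact div_nonpos_of_nonpos_of_nonneg
      (div_nonpos_of_nonpos_of_nonneg h (Complex.normSq_nonneg _)) (norm_nonneg _)
  · have h₁ : P (i + 1) - P i ≠ 0 := by
      rintro h₁
      simp [cross, h₁] at h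
    have h₂ : P (i + 2) - P (i + 1) ≠ 0 := by
      rintro h₂
      simp [cross, h₂] at h
    exact div_pos (div_pos h (Complex.normSq_pos.2 h₂))
      (norm_pos_iff.2 (div_ne_zero (neg_ne_zero.2 h₁) h₂))

lemma locallyConvex_iff {P : Polygon ℂ 5} :
    LocallyConvex P ↔ ∀ i, interiorAngle P i ∈ Set.Ioo 0 π := by
  rw [← (Equiv.addRight 1).forall_congr_right]
  exact forall_congr' fun i ↦ interiorAngle_mem_Ioo_iff.symm

namespace LocallyConvex

variable {P : Polygon ℂ 5} (h : LocallyConvex P)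
include h

lemma edgeLength_pos (i : Fin 5) : 0 < edgeLength P i := by
  refine dist_pos.2 fun heq ↦ (h i).ne' ?_
  simp [orient, cross, heq]

lemma edgeLength_mul_edgeDir (i : Fin 5) :
    (edgeLength P i : ℂ) * edgeDir P i = P (i + 1) - P i :=
  mul_div_cancel₀ _ (Complex.ofReal_ne_zero.2 (h.edgeLength_pos i).ne')

lemma norm_edgeDir (i : Fin 5) : ‖edgeDir P i‖ = 1 := by
  rw [edgeDir, norm_div, Complex.norm_of_nonneg (h.edgeLength_pos i).le, ← dist_eq_norm',
    ← edgeLength, div_self (h.edgeLength_pos i).ne']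

lemma edgeDir_ne_zero (i : Fin 5) : edgeDir P i ≠ 0 :=
  norm_ne_zero_iff.1 (by rw [h.norm_edgeDir]; exact one_ne_zero)

lemma edgeDir_add_one (i : Fin 5) :
    edgeDir P (i + 1) = -edgeDir P i * Complex.exp (-(interiorAngle P (i + 1) * Complex.I)) := by
  have hL (j : Fin 5) : (edgeLength P j : ℂ) ≠ 0 :=
    Complex.ofReal_ne_zero.2 (h.edgeLength_pos j).ne'
  have hd := h.edgeDir_ne_zero
  have he := h.edgeLength_mul_edgeDir (i + 1)
  simp only [add_assoc, Fin.reduceAdd] at he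
  rw [Complex.exp_neg, interiorAngle_add_one, ← h.edgeLength_mul_edgeDir i, ← he,
    exp_toIcoMod_arg_mul_I (by simp [hL, hd])]
  have hnorm (j : Fin 5) : ‖(edgeLength P j : ℂ)‖ = edgeLength P j :=
    Complex.norm_of_nonneg dist_nonneg
  simp only [norm_div, norm_neg, norm_mul, h.norm_edgeDir, hnorm]
  push_cast
  field_simp [hL i, hL (i + 1), hd i, hd (i + 1)]

lemma conj_edgeDir_mul_self (i : Fin 5) : conj (edgeDir P i) * edgeDir P i = 1 := by
  rw [Complex.conj_mul', h.norm_edgeDir, Complex.ofReal_one, one_pow]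

lemma cross_edgeDir_add_one (i : Fin 5) :
    cross (edgeDir P i) (edgeDir P (i + 1)) = Real.sin (interiorAngle P (i + 1)) := by
  rw [← im_conj_mul, h.edgeDir_add_one, ← mul_assoc, mul_neg, h.conj_edgeDir_mul_self,
    neg_one_mul, Complex.neg_im, ← neg_mul, ← Complex.ofReal_neg, Complex.exp_ofReal_mul_I_im,
    Real.sin_neg, neg_neg]

lemma cross_edgeDir_add_two (i : Fin 5) : cross (edgeDir P i) (edgeDir P (i + 2)) =
    -Real.sin (interiorAngle P (i + 1) + interiorAngle P (i + 2)) := by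
  have hsucc := h.edgeDir_add_one (i + 1)
  simp only [add_assoc, Fin.reduceAdd] at hsucc
  rw [← im_conj_mul, hsucc, h.edgeDir_add_one i, neg_mul (edgeDir P i), neg_neg, mul_assoc,
    ← mul_assoc, h.conj_edgeDir_mul_self, one_mul, ← Complex.exp_add, ← neg_add, ← add_mul,
    ← neg_mul, ← Complex.ofReal_add, ← Complex.ofReal_neg, Complex.exp_ofReal_mul_I_im,
    Real.sin_neg]

lemma cross_edges_add_two (i : Fin 5) : cross (P (i + 1) - P i) (P (i + 3) - P (i + 2)) =
    -(edgeLength P i * edgeLength P (i + 2) *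
      Real.sin (interiorAngle P (i + 1) + interiorAngle P (i + 2))) := by
  have he := h.edgeLength_mul_edgeDir (i + 2)
  simp only [add_assoc, Fin.reduceAdd] at he
  rw [← h.edgeLength_mul_edgeDir i, ← he, cross_ofReal_mul, h.cross_edgeDir_add_two, mul_neg]

lemma interiorAngle_pos (i : Fin 5) : 0 < interiorAngle P i := (locallyConvex_iff.1 h i).1

lemma interiorAngle_lt_pi (i : Fin 5) : interiorAngle P i < π := (locallyConvex_iff.1 h i).2

lemma cos_sum_interiorAngle : Real.cos (∑ i, interiorAngle P i) = -1 := by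
  have hprod : Complex.exp ((-∑ i, interiorAngle P i : ℝ) * Complex.I) = -1 := by
    have h₀ := h.edgeDir_add_one 0
    have h₁ := h.edgeDir_add_one 1
    have h₂ := h.edgeDir_add_one 2
    have h₃ := h.edgeDir_add_one 3
    have h₄ := h.edgeDir_add_one 4
    simp only [Fin.reduceAdd, zero_add] at h₀ h₁ h₂ h₃ h₄
    rw [h₃, h₂, h₁, h₀] at h₄
    rw [← mul_right_inj' (h.edgeDir_ne_zero 0), Fin.sum_univ_five]
    push_cast
    simp only [neg_add, add_mul, neg_mul, Complex.exp_add]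
    linear_combination h₄
  have hre := congrArg Complex.re hprod
  rwa [Complex.exp_ofReal_mul_I_re, Real.cos_neg, Complex.neg_re, Complex.one_re] at hre

lemma sum_interiorAngle_eq_pi_or :
    ∑ i, interiorAngle P i = π ∨ ∑ i, interiorAngle P i = 3 * π := by
  have hcos : Real.cos (∑ i, interiorAngle P i - π) = 1 := by
    rw [Real.cos_sub_pi, h.cos_sum_interiorAngle, neg_neg]
  obtain ⟨n, hn⟩ := (Real.cos_eq_one_iff _).1 hcos
  have hlo : 0 < ∑ i, interiorAngle P i :=
    Finset.sum_pos (fun i _ ↦ h.interiorAngle_pos i) Finset.univ_nonempty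
  have hhi : ∑ i, interiorAngle P i < 5 * π := by
    simpa using Finset.sum_lt_sum_of_nonempty Finset.univ_nonempty
      fun i _ ↦ h.interiorAngle_lt_pi i
  have n_lo : (-1 : ℝ) < n := by nlinarith [Real.pi_pos]
  have n_hi : (n : ℝ) < 2 := by nlinarith [Real.pi_pos]
  norm_cast at n_lo n_hi
  obtain rfl | rfl : n = 0 ∨ n = 1 := by lia
  · left; push_cast at hn; linarith
  · right; push_cast at hn; linarith

end LocallyConvex

lemma orient_lineMap (a b p q : ℂ) (r : ℝ) :
    orient a b (AffineMap.lineMap p q r) = (1 - r) * orient a b p + r * orient a b q := by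
  simp only [AffineMap.lineMap_apply, vsub_eq_sub, vadd_eq_add, Complex.real_smul, orient, cross,
    Complex.sub_re, Complex.sub_im, Complex.add_re, Complex.add_im, Complex.re_ofReal_mul,
    Complex.im_ofReal_mul]
  ring

lemma orient_left (a b : ℂ) : orient a b a = 0 := by
  simp [orient, cross]

lemma orient_right (a b : ℂ) : orient a b b = 0 := by
  simp only [orient, cross]
  ring

lemma orient_eq_zero_of_mem_affineSegment {a b x : ℂ} (hx : x ∈ affineSegment ℝ a b) :
    orient a b x = 0 := by
  obtain ⟨r, -, rfl⟩ := hx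
  rw [orient_lineMap, orient_left, orient_right, mul_zero, mul_zero, add_zero]

lemma orient_pos_of_mem_affineSegment {a b p q x : ℂ} (hp : 0 < orient a b p)
    (hq : 0 < orient a b q) (hx : x ∈ affineSegment ℝ p q) : 0 < orient a b x := by
  obtain ⟨r, ⟨hr₀, hr₁⟩, rfl⟩ := hx
  rw [orient_lineMap]
  exact convex_Ioi (0 : ℝ) hp hq (sub_nonneg.2 hr₁) hr₀ (sub_add_cancel 1 r)

lemma isSimple_of_orient_pos {P : Polygon ℂ 5}
    (h : ∀ i j, j ≠ i → j ≠ i + 1 → 0 < orient (P i) (P (i + 1)) (P j)) : IsSimple P where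
  consecutive i := by
    rw [edgeSet_eq, edgeSet_eq]
    refine Set.eq_singleton_iff_unique_mem.2
      ⟨⟨right_mem_affineSegment .., left_mem_affineSegment ..⟩, ?_⟩
    rintro _ ⟨hx, r, -, rfl⟩
    have hzero := orient_eq_zero_of_mem_affineSegment hx
    rw [orient_lineMap, orient_right, mul_zero, zero_add, mul_eq_zero] at hzero
    have hr := hzero.resolve_right (h i _ (by simp [add_assoc]) (by simp)).ne'
    rw [hr, AffineMap.lineMap_apply_zero]
  nonconsecutive i j hi hi' hj := by
    rw [edgeSet_eq, edgeSet_eq]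
    exact Set.disjoint_left.2 fun x hx hx' ↦ (orient_pos_of_mem_affineSegment (h i j hi hi')
      (h i (j + 1) hj.symm (by simpa using hi)) hx').ne' (orient_eq_zero_of_mem_affineSegment hx)

namespace LocallyConvex

variable {P : Polygon ℂ 5} (h : LocallyConvex P)
include h

lemma orient_add_three (i : Fin 5) :
    orient (P i) (P (i + 1)) (P (i + 3)) = orient (P i) (P (i + 1)) (P (i + 2)) -
      edgeLength P i * edgeLength P (i + 2) *
        Real.sin (interiorAngle P (i + 1) + interiorAngle P (i + 2)) := by
  rw [sub_eq_add_neg, ← h.cross_edges_add_two]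
  simp only [orient, cross, Complex.sub_re, Complex.sub_im]
  ring

lemma orient_add_three' (i : Fin 5) :
    orient (P i) (P (i + 1)) (P (i + 3)) = orient (P (i + 4)) (P i) (P (i + 1)) -
      edgeLength P (i + 3) * edgeLength P i *
        Real.sin (interiorAngle P (i + 4) + interiorAngle P i) := by
  have hcross := h.cross_edges_add_two (i + 3)
  simp only [add_assoc, Fin.reduceAdd, add_zero] at hcross
  rw [sub_eq_add_neg, ← hcross]
  simp only [orient, cross, Complex.sub_re, Complex.sub_im]
  ring

lemma sum_interiorAngle (hs : IsSimple P) : ∑ i, interiorAngle P i = 3 * π := by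
  refine h.sum_interiorAngle_eq_pi_or.resolve_left fun hsum ↦ ?_
  obtain ⟨i, hlt⟩ := hs.exists_lt_orient h
  rw [h.orient_add_three] at hlt
  have hpos := h.interiorAngle_pos
  rw [sum_fin_five_shift _ i] at hsum
  have hsin : 0 ≤ Real.sin (interiorAngle P (i + 1) + interiorAngle P (i + 2)) :=
    Real.sin_nonneg_of_nonneg_of_le_pi (by linarith [hpos (i + 1), hpos (i + 2)])
      (by linarith [hpos i, hpos (i + 3), hpos (i + 4)])
  have := mul_nonneg (mul_pos (h.edgeLength_pos i) (h.edgeLength_pos (i + 2))).le hsin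
  linarith

lemma sin_add_nonpos {i j : Fin 5} (hij : π ≤ interiorAngle P i + interiorAngle P j) :
    Real.sin (interiorAngle P i + interiorAngle P j) ≤ 0 := by
  have := Real.sin_nonneg_of_nonneg_of_le_pi (sub_nonneg.2 hij)
    (by linarith [h.interiorAngle_lt_pi i, h.interiorAngle_lt_pi j])
  rw [Real.sin_sub_pi] at this
  linarith

lemma orient_add_three_pos (hsum : ∑ i, interiorAngle P i = 3 * π) (i : Fin 5) :
    0 < orient (P i) (P (i + 1)) (P (i + 3)) := by
  have hL := h.edgeLength_pos
  obtain hpair | hpair : π ≤ interiorAngle P (i + 1) + interiorAngle P (i + 2) ∨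
      π ≤ interiorAngle P (i + 4) + interiorAngle P i := by
    by_contra! hlt
    rw [sum_fin_five_shift _ i] at hsum
    linarith [h.interiorAngle_lt_pi (i + 3)]
  · rw [h.orient_add_three]
    have := mul_nonpos_of_nonneg_of_nonpos (mul_pos (hL i) (hL (i + 2))).le
      (h.sin_add_nonpos hpair)
    linarith [h i]
  · rw [h.orient_add_three']
    have := mul_nonpos_of_nonneg_of_nonpos (mul_pos (hL (i + 3)) (hL i)).le
      (h.sin_add_nonpos hpair)
    have hturn := h (i + 4)
    simp only [add_assoc, Fin.reduceAdd, add_zero] at hturn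
    linarith

lemma isSimple (hsum : ∑ i, interiorAngle P i = 3 * π) : IsSimple P := by
  refine isSimple_of_orient_pos fun i j hj hj' ↦ ?_
  obtain rfl | rfl | rfl : j = i + 2 ∨ j = i + 3 ∨ j = i + 4 := by lia
  · exact h i
  · exact h.orient_add_three_pos hsum i
  · have hturn := h (i + 4)
    simp only [add_assoc, Fin.reduceAdd, add_zero] at hturn
    rwa [← orient_rotate]

end LocallyConvex

lemma mul_nonpos_and_eq_zero_of_mul_add_mul_eq_zero {a b x y : ℝ} (hx : 0 < x) (hy : 0 < y)
    (h : a * x + b * y = 0) : a * b ≤ 0 ∧ (a * b = 0 → a = 0 ∧ b = 0) := by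
  have hb : b = -(a * x / y) := by
    field_simp
    linarith
  refine ⟨?_, fun hab ↦ ?_⟩
  · rw [hb, mul_neg, ← mul_div_assoc, ← mul_assoc, neg_nonpos]
    have := mul_self_nonneg a
    positivity
  · rcases mul_eq_zero.1 hab with h0 | h0
    · simp [hb, h0]
    · simpa [h0, hx.ne'] using h

lemma two_mul_signedArea_eq_cross_edges (P : Polygon ℂ 5) (k : Fin 5) :
    2 * signedArea P = cross (P (k + 1) - P k) (P (k + 2) - P (k + 1)) +
      (cross (P (k + 1) - P k) (P (k + 3) - P (k + 2)) +
        cross (P (k + 2) - P (k + 1)) (P (k + 3) - P (k + 2))) +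
      cross (P (k + 4) - P (k + 3)) (P k - P (k + 4)) := by
  simp only [signedArea_eq P k, cross, Complex.sub_re, Complex.sub_im]
  ring

-- The hypothesis `hm` says that the lines of the edges `k`, `k + 2`, `k + 4` are concurrent. Then
-- the pentagon splits into two negatively oriented triangles.
lemma signedArea_nonpos_of_degenerate {P : Polygon ℂ 5} {u : Fin 5 → ℂ} {m : Fin 5 → ℝ}
    {k : Fin 5} (hP : ∀ i, P (i + 1) - P i = m i * u i)
    (hu : ∀ i, 0 < cross (u i) (u (i + 1)))
    (h₀₂ : 0 < cross (u k) (u (k + 2))) (h₂₄ : 0 < cross (u (k + 2)) (u (k + 4)))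
    (hm : m k * cross (u k) (u (k + 2)) + m (k + 1) * cross (u (k + 1)) (u (k + 2)) = 0) :
    signedArea P ≤ 0 ∧ (signedArea P = 0 → ∀ i, m i = 0) := by
  have e₀ := hP k
  have e₁ := hP (k + 1)
  have e₂ := hP (k + 2)
  have e₃ := hP (k + 3)
  have e₄ := hP (k + 4)
  have u₁ := hu (k + 1)
  have u₂ := hu (k + 2)
  have u₃ := hu (k + 3)
  simp only [add_assoc, Fin.reduceAdd, add_zero] at e₁ e₂ e₃ e₄ u₁ u₂ u₃
  have closed : (m k : ℂ) * u k + m (k + 1) * u (k + 1) + m (k + 2) * u (k + 2) +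
      m (k + 3) * u (k + 3) + m (k + 4) * u (k + 4) = 0 := by
    linear_combination -e₀ - e₁ - e₂ - e₃ - e₄
  have hm' : m (k + 3) * cross (u (k + 2)) (u (k + 3)) +
      m (k + 4) * cross (u (k + 2)) (u (k + 4)) = 0 := by
    have hre := congrArg Complex.re closed
    have him := congrArg Complex.im closed
    simp only [Complex.add_re, Complex.add_im, Complex.re_ofReal_mul, Complex.im_ofReal_mul,
      Complex.zero_re, Complex.zero_im] at hre him
    simp only [cross] at hm ⊢
    linear_combination (u (k + 2)).re * him - (u (k + 2)).im * hre + hm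
  have area : 2 * signedArea P = m k * m (k + 1) * cross (u k) (u (k + 1)) +
      m (k + 3) * m (k + 4) * cross (u (k + 3)) (u (k + 4)) := by
    rw [two_mul_signedArea_eq_cross_edges P k, e₀, e₁, e₂, e₃, e₄]
    simp only [cross_ofReal_mul]
    linear_combination m (k + 2) * hm
  obtain ⟨h₀₁, h₀₁'⟩ := mul_nonpos_and_eq_zero_of_mul_add_mul_eq_zero h₀₂ u₁ hm
  obtain ⟨h₃₄, h₃₄'⟩ := mul_nonpos_and_eq_zero_of_mul_add_mul_eq_zero u₂ h₂₄ hm'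
  have t₀₁ := mul_nonpos_of_nonpos_of_nonneg h₀₁ (hu k).le
  have t₃₄ := mul_nonpos_of_nonpos_of_nonneg h₃₄ u₃.le
  refine ⟨by linarith, fun hzero i ↦ ?_⟩
  obtain ⟨m₀, m₁⟩ := h₀₁' ((mul_eq_zero.1 (by linarith)).resolve_right (hu k).ne')
  obtain ⟨m₃, m₄⟩ := h₃₄' ((mul_eq_zero.1 (by linarith)).resolve_right u₃.ne')
  have hu₂ : u (k + 2) ≠ 0 := by
    rintro h
    simp [cross, h] at u₁
  have m₂ : m (k + 2) = 0 := by simpa [m₀, m₁, m₃, m₄, hu₂] using closed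
  obtain rfl | rfl | rfl | rfl | rfl :
    i = k ∨ i = k + 1 ∨ i = k + 2 ∨ i = k + 3 ∨ i = k + 4 := by lia
  all_goals assumption

/-- The cotangents of the half-angles of a pentagon. -/
noncomputable def cotHalf (P : Polygon ℂ 5) (i : Fin 5) : ℝ := Real.cot (interiorAngle P i / 2)

/-- The pentagon circumscribed about the unit circle with the angles and the edge directions of a
given locally convex pentagon. Edge `i` touches the circle at `-Complex.I * edgeDir P i`. -/
noncomputable def tangential (P : Polygon ℂ 5) : Polygon ℂ 5 :=
  ⟨fun i ↦ -(Complex.I + cotHalf P i) * edgeDir P i⟩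

lemma tangential_apply (P : Polygon ℂ 5) (i : Fin 5) :
    tangential P i = -(Complex.I + cotHalf P i) * edgeDir P i := rfl

lemma cot_pos {x : ℝ} (hx₀ : 0 < x) (hx₁ : x < π / 2) : 0 < Real.cot x := by
  rw [← Real.tan_inv_eq_cot]
  exact inv_pos.2 (Real.tan_pos_of_pos_of_lt_pi_div_two hx₀ hx₁)

lemma sub_eq_I_mul_cot_half_mul_add {a : ℝ} {u v : ℂ} (ha : a ∈ Set.Ioo 0 π)
    (hv : v = -u * Complex.exp (-(a * Complex.I))) :
    v - u = Complex.I * Real.cot (a / 2) * (v + u) := by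
  have hexp : Complex.exp (a * Complex.I) ≠ 1 := by
    intro heq
    have := congrArg Complex.im heq
    rw [Complex.exp_ofReal_mul_I_im, Complex.one_im] at this
    exact (Real.sin_pos_of_mem_Ioo ha).ne' this
  have hne : 1 - Complex.exp (a * Complex.I) ≠ 0 := sub_ne_zero.2 hexp.symm
  have hexp₀ := Complex.exp_ne_zero (a * Complex.I)
  have harg : 2 * Complex.I * ((a / 2 : ℝ) : ℂ) = a * Complex.I := by
    push_cast
    ring
  rw [Complex.ofReal_cot, Complex.cot_eq_exp_ratio, harg, hv, Complex.exp_neg]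
  field_simp
  ring

lemma signedArea_sub_smul (P Q : Polygon ℂ 5) (s : ℝ) :
    2 * signedArea ⟨fun i ↦ P i - s * Q i⟩ = 2 * signedArea P -
      s * (∑ i, (cross (Q i) (P (i + 1) - P i) + cross (Q (i + 1)) (P (i + 1) - P i))) +
        s ^ 2 * (2 * signedArea Q) := by
  simp only [signedArea_eq _ 0, sum_fin_five_shift _ 0, zero_add, Fin.reduceAdd, cross,
    Complex.sub_re, Complex.sub_im, Complex.re_ofReal_mul, Complex.im_ofReal_mul]
  ring

lemma eq_apply_zero_of_add_one_eq {α : Type*} {f : Fin 5 → α} (h : ∀ i, f (i + 1) = f i)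
    (i : Fin 5) : f i = f 0 := by
  induction i using Fin.induction with
  | zero => rfl
  | succ i ih => rw [← Fin.coeSucc_eq_succ, h, ih]

lemma signedArea_of_eq_add_mul {P Q : Polygon ℂ 5} {c : ℂ} {s : ℝ} (hP : ∀ i, P i = c + s * Q i) :
    signedArea P = s ^ 2 * signedArea Q := by
  simp only [signedArea_eq _ 0, zero_add, hP, cross, Complex.add_re, Complex.add_im,
    Complex.re_ofReal_mul, Complex.im_ofReal_mul]
  ring

lemma perimeter_of_eq_add_mul {P Q : Polygon ℂ 5} {c : ℂ} {s : ℝ} (hs : 0 ≤ s)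
    (hP : ∀ i, P i = c + s * Q i) : perimeter P = s * perimeter Q := by
  simp only [perimeter, hP, Finset.mul_sum, dist_eq_norm, add_sub_add_left_eq_sub, ← mul_sub,
    norm_mul, Complex.norm_real, Real.norm_of_nonneg hs]

namespace LocallyConvex

variable {P : Polygon ℂ 5} (h : LocallyConvex P)
include h

lemma cotHalf_pos (i : Fin 5) : 0 < cotHalf P i :=
  cot_pos (half_pos (h.interiorAngle_pos i)) (by linarith [h.interiorAngle_lt_pi i])

lemma sum_cotHalf_pos : 0 < ∑ i, cotHalf P i :=
  Finset.sum_pos (fun i _ ↦ h.cotHalf_pos i) Finset.univ_nonempty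

lemma edgeDir_add_one_sub (i : Fin 5) : edgeDir P (i + 1) - edgeDir P i =
    Complex.I * cotHalf P (i + 1) * (edgeDir P (i + 1) + edgeDir P i) :=
  sub_eq_I_mul_cot_half_mul_add (locallyConvex_iff.1 h (i + 1)) (h.edgeDir_add_one i)

lemma tangential_edge (i : Fin 5) : tangential P (i + 1) - tangential P i =
    ((cotHalf P i + cotHalf P (i + 1) : ℝ) : ℂ) * edgeDir P i := by
  simp only [tangential_apply]
  push_cast
  linear_combination -Complex.I * h.edgeDir_add_one_sub i -
    cotHalf P (i + 1) * (edgeDir P (i + 1) + edgeDir P i) * Complex.I_sq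

lemma cross_tangential_edgeDir (i : Fin 5) : cross (tangential P i) (edgeDir P i) = 1 := by
  have hn : (edgeDir P i).re * (edgeDir P i).re + (edgeDir P i).im * (edgeDir P i).im = 1 := by
    rw [← Complex.normSq_apply, Complex.normSq_eq_norm_sq, h.norm_edgeDir, one_pow]
  simp only [tangential_apply, cross, neg_mul, add_mul, Complex.neg_re, Complex.neg_im,
    Complex.add_re, Complex.add_im, Complex.I_mul_re, Complex.I_mul_im, Complex.re_ofReal_mul,
    Complex.im_ofReal_mul]
  linear_combination hn

lemma cross_tangential_add_one_edgeDir (i : Fin 5) :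
    cross (tangential P (i + 1)) (edgeDir P i) = 1 := by
  rw [eq_add_of_sub_eq (h.tangential_edge i), ← h.cross_tangential_edgeDir i]
  simp only [cross, Complex.add_re, Complex.add_im, Complex.re_ofReal_mul, Complex.im_ofReal_mul]
  ring

lemma cross_tangential_tangential_add_one (i : Fin 5) :
    cross (tangential P i) (tangential P (i + 1)) = cotHalf P i + cotHalf P (i + 1) := by
  have hself : cross (tangential P i) (tangential P i) = 0 := by
    simp only [cross]
    ring
  have hfoot := h.cross_tangential_edgeDir i
  rw [eq_add_of_sub_eq (h.tangential_edge i)]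
  simp only [cross, Complex.add_re, Complex.add_im, Complex.re_ofReal_mul,
    Complex.im_ofReal_mul] at hfoot hself ⊢
  linear_combination (cotHalf P i + cotHalf P (i + 1)) * hfoot + hself

omit h in
lemma sum_cotHalf_add_cotHalf_add_one :
    ∑ i, (cotHalf P i + cotHalf P (i + 1)) = 2 * ∑ i, cotHalf P i := by
  have hshift : ∑ i, cotHalf P (i + 1) = ∑ i, cotHalf P i :=
    Equiv.sum_comp (Equiv.addRight (1 : Fin 5)) (cotHalf P)
  rw [Finset.sum_add_distrib, hshift, two_mul]

lemma signedArea_tangential : signedArea (tangential P) = ∑ i, cotHalf P i := by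
  simp only [signedArea, im_conj_mul, h.cross_tangential_tangential_add_one,
    sum_cotHalf_add_cotHalf_add_one]
  ring

lemma perimeter_tangential : perimeter (tangential P) = 2 * ∑ i, cotHalf P i := by
  have hpos (i : Fin 5) : 0 < cotHalf P i + cotHalf P (i + 1) :=
    add_pos (h.cotHalf_pos i) (h.cotHalf_pos (i + 1))
  simp only [perimeter, dist_eq_norm', h.tangential_edge, norm_mul, h.norm_edgeDir, mul_one,
    Complex.norm_real, Real.norm_of_nonneg (hpos _).le, sum_cotHalf_add_cotHalf_add_one]

lemma signedArea_sub_tangential (s : ℝ) :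
    signedArea ⟨fun i ↦ P i - s * tangential P i⟩ =
      signedArea P - s * perimeter P + s ^ 2 * ∑ i, cotHalf P i := by
  have mixed (i : Fin 5) : cross (tangential P i) (P (i + 1) - P i) +
      cross (tangential P (i + 1)) (P (i + 1) - P i) = 2 * dist (P i) (P (i + 1)) := by
    have hfoot := h.cross_tangential_edgeDir i
    have hfoot' := h.cross_tangential_add_one_edgeDir i
    rw [← h.edgeLength_mul_edgeDir i, edgeLength]
    simp only [cross, Complex.re_ofReal_mul, Complex.im_ofReal_mul] at hfoot hfoot' ⊢
    linear_combination dist (P i) (P (i + 1)) * (hfoot + hfoot')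
  have hexpand := signedArea_sub_smul P (tangential P) s
  simp only [mixed, ← Finset.mul_sum, h.signedArea_tangential] at hexpand
  rw [perimeter]
  linarith

lemma cross_edgeDir_add_one_pos (i : Fin 5) : 0 < cross (edgeDir P i) (edgeDir P (i + 1)) := by
  rw [h.cross_edgeDir_add_one]
  exact Real.sin_pos_of_mem_Ioo (locallyConvex_iff.1 h (i + 1))

lemma cross_edgeDir_add_two_pos {i : Fin 5}
    (hi : π < interiorAngle P (i + 1) + interiorAngle P (i + 2)) :
    0 < cross (edgeDir P i) (edgeDir P (i + 2)) := by
  rw [h.cross_edgeDir_add_two, ← Real.sin_sub_pi]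
  exact Real.sin_pos_of_pos_of_lt_pi (by linarith)
    (by linarith [h.interiorAngle_lt_pi (i + 1), h.interiorAngle_lt_pi (i + 2)])

lemma exists_pi_lt_and_pi_lt (hsum : ∑ i, interiorAngle P i = 3 * π) :
    ∃ k, π < interiorAngle P (k + 1) + interiorAngle P (k + 2) ∧
      π < interiorAngle P (k + 3) + interiorAngle P (k + 4) := by
  obtain ⟨k, hk, hk'⟩ := exists_and_add_two_of_forall_or
    (p := fun i ↦ π < interiorAngle P (i + 1) + interiorAngle P (i + 2)) fun i ↦ by
      by_contra! hle
      simp only [add_assoc, Fin.reduceAdd] at hle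
      rw [sum_fin_five_shift _ i] at hsum
      linarith [h.interiorAngle_lt_pi i]
  simp only [add_assoc, Fin.reduceAdd] at hk'
  exact ⟨k, hk, hk'⟩

-- For a suitable `s` the lines of three edges of `P - s * tangential P` are concurrent.
lemma exists_quadratic_nonpos (hsum : ∑ i, interiorAngle P i = 3 * π) :
    ∃ s : ℝ, signedArea P - s * perimeter P + s ^ 2 * ∑ i, cotHalf P i ≤ 0 ∧
      (signedArea P - s * perimeter P + s ^ 2 * ∑ i, cotHalf P i = 0 →
        ∀ i, edgeLength P i = s * (cotHalf P i + cotHalf P (i + 1))) := by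
  obtain ⟨k, hk, hk'⟩ := h.exists_pi_lt_and_pi_lt hsum
  have h₀₂ := h.cross_edgeDir_add_two_pos hk
  have h₂₄ := h.cross_edgeDir_add_two_pos (i := k + 2)
    (by simpa only [add_assoc, Fin.reduceAdd] using hk')
  have h₁₂ := h.cross_edgeDir_add_one_pos (k + 1)
  simp only [add_assoc, Fin.reduceAdd] at h₂₄ h₁₂
  let defect (l : Fin 5 → ℝ) : ℝ := l k * cross (edgeDir P k) (edgeDir P (k + 2)) +
    l (k + 1) * cross (edgeDir P (k + 1)) (edgeDir P (k + 2))
  let q (i : Fin 5) : ℝ := cotHalf P i + cotHalf P (i + 1)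
  have hq (i : Fin 5) : 0 < q i := add_pos (h.cotHalf_pos _) (h.cotHalf_pos _)
  have hdefect : 0 < defect q := add_pos (mul_pos (hq _) h₀₂) (mul_pos (hq _) h₁₂)
  let s := defect (edgeLength P) / defect q
  have hs : s * defect q = defect (edgeLength P) := div_mul_cancel₀ _ hdefect.ne'
  obtain ⟨hle, hzero⟩ := signedArea_nonpos_of_degenerate
    (P := ⟨fun i ↦ P i - s * tangential P i⟩) (u := edgeDir P)
    (m := fun i ↦ edgeLength P i - s * q i) (k := k)
    (fun i ↦ by
      have htan := h.tangential_edge i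
      push_cast [q] at htan ⊢
      linear_combination -h.edgeLength_mul_edgeDir i - s * htan)
    h.cross_edgeDir_add_one_pos h₀₂ h₂₄ (by linear_combination -hs)
  rw [h.signedArea_sub_tangential] at hle hzero
  exact ⟨s, hle, fun h0 i ↦ sub_eq_zero.1 (hzero h0 i)⟩

theorem lhuilier (hsum : ∑ i, interiorAngle P i = 3 * π) :
    4 * signedArea P * ∑ i, cotHalf P i ≤ perimeter P ^ 2 := by
  obtain ⟨s, hs, -⟩ := h.exists_quadratic_nonpos hsum
  nlinarith [sq_nonneg (perimeter P - 2 * s * ∑ i, cotHalf P i), h.sum_cotHalf_pos]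

lemma exists_eq_add_mul_tangential {s : ℝ}
    (hs : ∀ i, edgeLength P i = s * (cotHalf P i + cotHalf P (i + 1))) :
    ∃ c : ℂ, ∀ i, P i = c + s * tangential P i := by
  refine ⟨P 0 - s * tangential P 0, fun i ↦ ?_⟩
  have hconst := eq_apply_zero_of_add_one_eq (f := fun i ↦ P i - s * tangential P i) (fun j ↦ by
    have hedge := h.edgeLength_mul_edgeDir j
    have htan := h.tangential_edge j
    rw [hs j] at hedge
    push_cast at hedge htan
    linear_combination -hedge - s * htan) i
  linear_combination hconst

theorem lhuilier_eq_iff (hsum : ∑ i, interiorAngle P i = 3 * π) :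
    4 * signedArea P * ∑ i, cotHalf P i = perimeter P ^ 2 ↔
      ∃ (c : ℂ) (s : ℝ), 0 < s ∧ ∀ i, P i = c + s * tangential P i := by
  refine ⟨fun heq ↦ ?_, fun ⟨c, s, hs, hP⟩ ↦ ?_⟩
  · obtain ⟨s, hle, hedge⟩ := h.exists_quadratic_nonpos hsum
    have hcot := h.sum_cotHalf_pos
    have hge : 0 ≤ signedArea P - s * perimeter P + s ^ 2 * ∑ i, cotHalf P i := by
      nlinarith [sq_nonneg (perimeter P - 2 * s * ∑ i, cotHalf P i)]
    specialize hedge (hle.antisymm hge)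
    have hs : 0 < s := by
      have hlen := h.edgeLength_pos 0
      rw [hedge] at hlen
      exact pos_of_mul_pos_left hlen (add_pos (h.cotHalf_pos _) (h.cotHalf_pos _)).le
    obtain ⟨c, hP⟩ := h.exists_eq_add_mul_tangential hedge
    exact ⟨c, s, hs, hP⟩
  · rw [signedArea_of_eq_add_mul hP, perimeter_of_eq_add_mul hs.le hP, h.signedArea_tangential,
      h.perimeter_tangential]
    ring

end LocallyConvex

lemma inner_ofReal_mul_I_mul (x y : ℝ) (u : ℂ) :
    inner ℝ ((x : ℂ) * u) (y * (Complex.I * u)) = 0 := by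
  simp only [Complex.inner, map_mul, Complex.conj_ofReal, Complex.mul_re, Complex.mul_im,
    Complex.ofReal_re, Complex.ofReal_im, Complex.I_re, Complex.I_im, Complex.conj_re,
    Complex.conj_im]
  ring

lemma eq_cross_mul_I_mul_of_inner_eq_zero {u w : ℂ} (hu : ‖u‖ = 1) (h : inner ℝ u w = 0) :
    w = cross u w * Complex.I * u := by
  have huu : conj u * u = 1 := by rw [Complex.conj_mul', hu]; simp
  have hz : conj u * w = cross u w * Complex.I := by
    rw [Complex.inner, mul_comm] at h
    apply Complex.ext
    · simpa using h
    · rw [im_conj_mul]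
      simp
  linear_combination u * hz - w * huu

namespace LocallyConvex

variable {P : Polygon ℂ 5} (h : LocallyConvex P)
include h

lemma isCircumscribed_of_eq_add_mul_tangential {c : ℂ} {s : ℝ} (hs : 0 < s)
    (hP : ∀ i, P i = c + s * tangential P i) : IsCircumscribed P := by
  refine ⟨⟨c, s⟩, hs, fun i ↦ ?_⟩
  have hcot := h.cotHalf_pos i
  have hcot' := h.cotHalf_pos (i + 1)
  let t : ℂ := c + (-s : ℝ) * (Complex.I * edgeDir P i)
  have left : P i - t = (-(s * cotHalf P i) : ℝ) * edgeDir P i := by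
    rw [hP, tangential_apply]
    push_cast [t]
    ring
  have right : P (i + 1) - t = (s * cotHalf P (i + 1) : ℝ) * edgeDir P i := by
    have htan := h.tangential_edge i
    rw [hP] at left ⊢
    push_cast at left htan ⊢
    linear_combination left + s * htan
  have mem_edge : t ∈ P.edgeSet ℝ i := by
    refine mem_edgeSet.2 ⟨cotHalf P i / (cotHalf P i + cotHalf P (i + 1)), by positivity,
      by rw [div_le_one] <;> linarith, ?_⟩
    have hne : (cotHalf P i + cotHalf P (i + 1) : ℂ) ≠ 0 := by
      exact_mod_cast (add_pos hcot hcot').ne'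
    push_cast at left right ⊢
    field_simp
    linear_combination -cotHalf P i * right - cotHalf P (i + 1) * left
  have orth (x : ℝ) : inner ℝ (x * edgeDir P i) (t - c) = 0 := by
    rw [show t - c = _ from add_sub_cancel_left ..]
    exact inner_ofReal_mul_I_mul ..
  refine ⟨t, mem_edge, ?_, ?_, ?_⟩
  · simp [EuclideanGeometry.mem_sphere, t, dist_eq_norm, h.norm_edgeDir, abs_of_pos hs]
  · rw [edgeSet_eq] at mem_edge
    exact Wbtw.mem_affineSpan mem_edge
  · rw [affineSpan_le, Set.pair_subset_iff]
    simp only [SetLike.mem_coe, EuclideanGeometry.Sphere.mem_orthRadius_iff_inner_left,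
      vsub_eq_sub, left, right]
    exact ⟨orth _, orth _⟩

lemma exists_eq_of_isTangentAt {s : EuclideanGeometry.Sphere ℂ} {t : ℂ} {i : Fin 5}
    (ht : t ∈ P.edgeSet ℝ i) (hst : s.IsTangentAt t line[ℝ, P i, P (i + 1)]) :
    ∃ η α β : ℝ, η ^ 2 = s.radius ^ 2 ∧ 0 ≤ α ∧ 0 ≤ β ∧
      P i = s.center - (α + η * Complex.I) * edgeDir P i ∧
      P (i + 1) = s.center + (β - η * Complex.I) * edgeDir P i := by
  obtain ⟨ρ, hρ₀, hρ₁, hρ⟩ := mem_edgeSet.1 ht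
  have hedge := h.edgeLength_mul_edgeDir i
  have hlen := h.edgeLength_pos i
  have orth : inner ℝ (edgeDir P i) (t - s.center) = 0 := by
    have left := hst.inner_left_eq_zero_of_mem (left_mem_affineSpan_pair ℝ _ _)
    have right := hst.inner_left_eq_zero_of_mem (right_mem_affineSpan_pair ℝ _ _)
    have hsub : inner ℝ (edgeLength P i • edgeDir P i) (t - s.center) = 0 := by
      rw [Complex.real_smul, hedge, ← sub_sub_sub_cancel_right _ _ t, inner_sub_left]
      exact sub_eq_zero.2 (right.trans left.symm)
    rw [real_inner_smul_left] at hsub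
    exact (mul_eq_zero.1 hsub).resolve_left hlen.ne'
  have foot := eq_cross_mul_I_mul_of_inner_eq_zero (h.norm_edgeDir i) orth
  refine ⟨-cross (edgeDir P i) (t - s.center), ρ * edgeLength P i, (1 - ρ) * edgeLength P i,
    ?_, by positivity, mul_nonneg (by linarith) hlen.le, ?_, ?_⟩
  · rw [← EuclideanGeometry.mem_sphere.1 hst.mem_sphere, dist_eq_norm]
    conv_rhs => rw [foot]
    simp [h.norm_edgeDir]
  · push_cast
    linear_combination foot - hρ + ρ * hedge
  · push_cast
    linear_combination foot - hρ - (1 - ρ) * hedge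

-- Both sides of `hvertex` are `P (i + 1) - c` where `c` is the centre of a circle of radius `r` to
-- which the two edges at that vertex are tangent; `α = β` since tangent segments are equal.
lemma eq_of_tangent_at_vertex {r η η' α β : ℝ} {i : Fin 5} (hr : 0 < r) (hη : η ^ 2 = r ^ 2)
    (hη' : η' ^ 2 = r ^ 2) (hα : 0 ≤ α) (hβ : 0 ≤ β)
    (hvertex : (β - η * Complex.I) * edgeDir P i =
      -((α + η' * Complex.I) * edgeDir P (i + 1))) :
    η' = r ∧ α = r * cotHalf P (i + 1) := by
  set t := cotHalf P (i + 1)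
  have htpos : 0 < t := h.cotHalf_pos _
  have hαβ : α = β := by
    have hnorm := congrArg (fun z ↦ ‖z‖ ^ 2) hvertex
    simp only [norm_neg, norm_mul, h.norm_edgeDir, mul_one, ← Complex.normSq_eq_norm_sq,
      sub_eq_add_neg, ← neg_mul, ← Complex.ofReal_neg, Complex.normSq_add_mul_I] at hnorm
    exact (pow_left_inj₀ hα hβ two_ne_zero).1 (by linarith)
  have hcoord : (1 - Complex.I * t) * (β - η * Complex.I) +
      (1 + Complex.I * t) * (α + η' * Complex.I) = 0 := by
    rw [← mul_left_inj' (h.edgeDir_ne_zero (i + 1)), zero_mul]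
    linear_combination (β - η * Complex.I) * h.edgeDir_add_one_sub i +
      (1 + Complex.I * t) * hvertex
  have hηη' : η' = η := by
    have him : -η - t * β + (η' + t * β) = 0 := by
      simpa [hαβ, sub_eq_add_neg] using congrArg Complex.im hcoord
    linarith
  have hβη : β = η * t := by
    have hre : β - t * η + (β - t * η) = 0 := by
      simpa [hαβ, hηη'] using congrArg Complex.re hcoord
    linarith
  have hηr : η = r := by
    refine (pow_left_inj₀ ?_ hr.le two_ne_zero).1 hη
    exact nonneg_of_mul_nonneg_left (hβη ▸ hβ) htpos
  rw [hηη', hαβ, hβη, hηr]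
  exact ⟨rfl, rfl⟩

lemma isCircumscribed_iff : IsCircumscribed P ↔
    ∃ (c : ℂ) (s : ℝ), 0 < s ∧ ∀ i, P i = c + s * tangential P i := by
  refine ⟨fun ⟨s, hs, ht⟩ ↦ ⟨s.center, s.radius, hs, fun i ↦ ?_⟩, fun ⟨c, s, hs, hP⟩ ↦
    h.isCircumscribed_of_eq_add_mul_tangential hs hP⟩
  obtain ⟨t, hmem, htan⟩ := ht (i - 1)
  obtain ⟨t', hmem', htan'⟩ := ht i
  obtain ⟨η, -, β, hη, -, hβ, -, hvertex⟩ := h.exists_eq_of_isTangentAt hmem htan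
  obtain ⟨η', α, -, hη', hα, -, hvertex', -⟩ := h.exists_eq_of_isTangentAt hmem' htan'
  obtain ⟨rfl, rfl⟩ := h.eq_of_tangent_at_vertex (i := i - 1) hs hη hη' hα hβ (by
    rw [sub_add_cancel] at hvertex ⊢
    linear_combination hvertex' - hvertex)
  rw [hvertex', tangential_apply, sub_add_cancel]
  push_cast
  ring

theorem four_mul_signedArea_mul_sum_cotHalf_eq_iff (hsum : ∑ i, interiorAngle P i = 3 * π) :
    4 * signedArea P * ∑ i, cotHalf P i = perimeter P ^ 2 ↔ IsCircumscribed P := by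
  rw [h.lhuilier_eq_iff hsum, h.isCircumscribed_iff]

end LocallyConvex

lemma interiorAngle_eq_of_edges {P : Polygon ℂ 5} {i : Fin 5} {l l' a : ℝ} {u v : ℂ}
    (hl : 0 < l) (hl' : 0 < l') (ha : a ∈ Set.Ioo 0 π) (hu : u ≠ 0)
    (hv : v = -u * Complex.exp (-(a * Complex.I))) (hedge : P (i + 1) - P i = l * u)
    (hedge' : P (i + 2) - P (i + 1) = l' * v) : interiorAngle P (i + 1) = a := by
  have hquot : -(P (i + 1) - P i) / (P (i + 2) - P (i + 1)) =
      ((l / l' : ℝ) : ℂ) * (Complex.cos a + Complex.sin a * Complex.I) := by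
    have hl'₀ : (l' : ℂ) ≠ 0 := Complex.ofReal_ne_zero.2 hl'.ne'
    have hexp := Complex.exp_ne_zero (a * Complex.I)
    rw [hedge, hedge', hv, ← Complex.exp_mul_I, Complex.exp_neg]
    push_cast
    field_simp
  rw [interiorAngle_add_one, hquot, Complex.arg_mul_cos_add_sin_mul_I (div_pos hl hl')
    ⟨by linarith [ha.1, Real.pi_pos], ha.2.le⟩, toIcoMod_eq_self]
  exact ⟨ha.1.le, by linarith [ha.2, Real.pi_pos]⟩

lemma edgeDir_eq_of_edge {P : Polygon ℂ 5} {i : Fin 5} {l : ℝ} {u : ℂ} (hl : 0 < l) (hu : ‖u‖ = 1)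
    (hedge : P (i + 1) - P i = l * u) : edgeDir P i = u := by
  rw [edgeDir, edgeLength, dist_eq_norm', hedge, norm_mul, hu, mul_one,
    Complex.norm_of_nonneg hl.le, mul_div_cancel_left₀ _ (Complex.ofReal_ne_zero.2 hl.ne')]

lemma exists_forall_add_one_eq_mul {M : Type*} [CommMonoid M] {e : Fin 5 → M}
    (he : ∏ i, e i = 1) : ∃ u : Fin 5 → M, u 0 = 1 ∧ ∀ i, u (i + 1) = u i * e (i + 1) := by
  refine ⟨![1, e 1, e 1 * e 2, e 1 * e 2 * e 3, e 1 * e 2 * e 3 * e 4], rfl, fun i ↦ ?_⟩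
  rw [Fin.prod_univ_five] at he
  fin_cases i
  · exact (one_mul _).symm
  · rfl
  · rfl
  · rfl
  · change 1 = e 1 * e 2 * e 3 * e 4 * e 0
    rw [← he]
    ac_rfl

lemma exists_edge_directions {a : Fin 5 → ℝ} (hsum : ∑ i, a i = 3 * π) :
    ∃ u : Fin 5 → ℂ, (∀ i, ‖u i‖ = 1) ∧
      ∀ i, u (i + 1) = -u i * Complex.exp (-(a (i + 1) * Complex.I)) := by
  have hprod : ∏ i, -Complex.exp (-(a i * Complex.I)) = 1 := by
    have hexp : Complex.exp (-(3 * π * Complex.I)) = -1 := by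
      rw [show -(3 * π * Complex.I) = -(π * Complex.I) - 2 * π * Complex.I by ring,
        Complex.exp_periodic.sub_eq, Complex.exp_neg, Complex.exp_pi_mul_I]
      norm_num
    rw [Finset.prod_neg, ← Complex.exp_sum, Finset.sum_neg_distrib, ← Finset.sum_mul,
      ← Complex.ofReal_sum, hsum, Complex.ofReal_mul, Complex.ofReal_ofNat, hexp]
    norm_num
  obtain ⟨u, hu₀, hu⟩ := exists_forall_add_one_eq_mul hprod
  refine ⟨u, fun i ↦ ?_, fun i ↦ by rw [hu]; ring⟩
  have hnorm (j : Fin 5) : ‖u (j + 1)‖ = ‖u j‖ := by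
    rw [hu, norm_mul, norm_neg, ← neg_mul, ← Complex.ofReal_neg, Complex.norm_exp_ofReal_mul_I,
      mul_one]
  rw [eq_apply_zero_of_add_one_eq (f := fun j ↦ ‖u j‖) hnorm i, hu₀, norm_one]

lemma exists_eq_mul_tangential {a : Fin 5 → ℝ} (ha : ∀ i, a i ∈ Set.Ioo 0 π)
    (hsum : ∑ i, a i = 3 * π) {s : ℝ} (hs : 0 < s) :
    ∃ P : Polygon ℂ 5, interiorAngle P = a ∧ ∀ i, P i = 0 + s * tangential P i := by
  obtain ⟨u, hu, hturn⟩ := exists_edge_directions hsum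
  let P : Polygon ℂ 5 := ⟨fun i ↦ s * (-(Complex.I + Real.cot (a i / 2)) * u i)⟩
  let l (i : Fin 5) : ℝ := s * (Real.cot (a i / 2) + Real.cot (a (i + 1) / 2))
  have hl (i : Fin 5) : 0 < l i := by
    have hcot (j : Fin 5) : 0 < Real.cot (a j / 2) :=
      cot_pos (half_pos (ha j).1) (by linarith [(ha j).2])
    exact mul_pos hs (add_pos (hcot i) (hcot (i + 1)))
  have hedge (i : Fin 5) : P (i + 1) - P i = l i * u i := by
    simp only [P, l, Complex.ofReal_mul, Complex.ofReal_add]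
    linear_combination -Complex.I * s * sub_eq_I_mul_cot_half_mul_add (ha (i + 1)) (hturn i) -
      s * Real.cot (a (i + 1) / 2) * (u (i + 1) + u i) * Complex.I_sq
  have hangle : interiorAngle P = a := by
    refine funext ((Equiv.addRight (1 : Fin 5)).forall_congr_right.1 fun i ↦ ?_)
    have hedge' := hedge (i + 1)
    simp only [add_assoc, Fin.reduceAdd] at hedge'
    exact interiorAngle_eq_of_edges (hl i) (hl (i + 1)) (ha (i + 1))
      (norm_ne_zero_iff.1 (by simp [hu])) (hturn i) (hedge i) hedge'
  refine ⟨P, hangle, fun i ↦ ?_⟩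
  rw [zero_add, tangential_apply, cotHalf, hangle, edgeDir_eq_of_edge (hl i) (hu i) (hedge i)]

theorem exists_isCircumscribed_of_sum_eq {a : Fin 5 → ℝ} (ha : ∀ i, a i ∈ Set.Ioo 0 π)
    (hsum : ∑ i, a i = 3 * π) :
    ∃ P : Polygon ℂ 5, IsUnitPentagon P ∧ IsCircumscribed P ∧ interiorAngle P = a := by
  have hcot : 0 < ∑ i, Real.cot (a i / 2) := Finset.sum_pos
    (fun i _ ↦ cot_pos (half_pos (ha i).1) (by linarith [(ha i).2])) Finset.univ_nonempty
  obtain ⟨P, rfl, htan⟩ := exists_eq_mul_tangential ha hsum (inv_pos.2 (Real.sqrt_pos.2 hcot))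
  have hP := locallyConvex_iff.2 ha
  refine ⟨P, ⟨hP.isSimple hsum, ?_⟩, hP.isCircumscribed_iff.2
    ⟨0, _, inv_pos.2 (Real.sqrt_pos.2 hcot), htan⟩, rfl⟩
  rw [signedArea_of_eq_add_mul htan, hP.signedArea_tangential, inv_pow, Real.sq_sqrt hcot.le]
  exact inv_mul_cancel₀ hcot.ne'

lemma tangent_lt_of_strictConvexOn {s : Set ℝ} {f : ℝ → ℝ} {x c f' : ℝ}
    (hf : StrictConvexOn ℝ s f) (hx : x ∈ s) (hc : c ∈ s) (hne : x ≠ c)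
    (hf' : HasDerivAt f f' c) : f c + f' * (x - c) < f x := by
  rcases hne.lt_or_gt with h | h
  · have := hf.slope_lt_of_hasDerivAt hx hc h hf'
    rw [slope_def_field, div_lt_iff₀ (sub_pos.2 h)] at this
    linarith
  · have := hf.lt_slope_of_hasDerivAt hc hx h hf'
    rw [slope_def_field, lt_div_iff₀ (sub_pos.2 h)] at this
    linarith

lemma sum_lt_sum_of_strictConvexOn {ι : Type*} [Fintype ι] {s : Set ℝ} {f f' : ℝ → ℝ}
    {x c : ι → ℝ} (hf : StrictConvexOn ℝ s f) (hf' : ∀ i, HasDerivAt f (f' (c i)) (c i))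
    (hx : ∀ i, x i ∈ s) (hc : ∀ i, c i ∈ s) (hne : x ≠ c)
    (hsum : 0 ≤ ∑ i, f' (c i) * (x i - c i)) : ∑ i, f (c i) < ∑ i, f (x i) := by
  have htangent : ∀ i, x i ≠ c i → f (c i) + f' (c i) * (x i - c i) < f (x i) := fun i h ↦
    tangent_lt_of_strictConvexOn hf (hx i) (hc i) h (hf' i)
  obtain ⟨j, hj⟩ := Function.ne_iff.1 hne
  calc ∑ i, f (c i) ≤ ∑ i, (f (c i) + f' (c i) * (x i - c i)) := by
        rw [Finset.sum_add_distrib]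
        linarith
    _ < ∑ i, f (x i) := by
        refine Finset.sum_lt_sum (fun i _ ↦ ?_) ⟨j, Finset.mem_univ j, htangent j hj⟩
        rcases eq_or_ne (x i) (c i) with h | h
        · simp [h]
        · exact (htangent i h).le

lemma hasDerivAt_cot_half {x : ℝ} (hx : x ∈ Set.Ioo 0 π) :
    HasDerivAt (fun y ↦ Real.cot (y / 2)) (-(1 + Real.cot (x / 2) ^ 2) / 2) x := by
  have hsin : Real.sin (x / 2) ≠ 0 :=
    (Real.sin_pos_of_pos_of_lt_pi (by linarith [hx.1]) (by linarith [hx.1, hx.2])).ne'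
  have hhalf : HasDerivAt (fun y : ℝ ↦ y / 2) (1 / 2) x := (hasDerivAt_id x).div_const 2
  have hquot := hhalf.cos.fun_div hhalf.sin hsin
  simp only [← Real.cot_eq_cos_div_sin] at hquot
  refine hquot.congr_deriv ?_
  rw [Real.cot_eq_cos_div_sin]
  field_simp
  ring

lemma cot_lt_cot {x y : ℝ} (hx : 0 < x) (hxy : x < y) (hy : y < π / 2) :
    Real.cot y < Real.cot x := by
  rw [← Real.tan_inv_eq_cot, ← Real.tan_inv_eq_cot]
  exact inv_strictAnti₀ (Real.tan_pos_of_pos_of_lt_pi_div_two hx (hxy.trans hy))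
    (Real.tan_lt_tan_of_nonneg_of_lt_pi_div_two hx.le hy hxy)

lemma strictConvexOn_cot_half :
    StrictConvexOn ℝ (Set.Ioo 0 π) fun x ↦ Real.cot (x / 2) := by
  refine StrictMonoOn.strictConvexOn_of_deriv (convex_Ioo 0 π)
    (fun x hx ↦ (hasDerivAt_cot_half hx).continuousAt.continuousWithinAt) ?_
  rw [interior_Ioo]
  intro x hx y hy hxy
  rw [(hasDerivAt_cot_half hx).deriv, (hasDerivAt_cot_half hy).deriv]
  have hcot : Real.cot (y / 2) < Real.cot (x / 2) :=
    cot_lt_cot (by linarith [hx.1]) (by linarith) (by linarith [hy.2])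
  have hpos : 0 < Real.cot (y / 2) := cot_pos (by linarith [hy.1]) (by linarith [hy.2])
  nlinarith

lemma cot_half_tangent_le {x c : ℝ} (hx : x ∈ Set.Ioo 0 π) (hc : c ∈ Set.Ioo 0 π) :
    Real.cot (c / 2) - (1 + Real.cot (c / 2) ^ 2) / 2 * (x - c) ≤ Real.cot (x / 2) := by
  rcases eq_or_ne x c with rfl | hne
  · simp
  · have := tangent_lt_of_strictConvexOn strictConvexOn_cot_half hx hc hne (hasDerivAt_cot_half hc)
    linarith

lemma sqrt_five_mem_Ioo : √5 ∈ Set.Ioo 2.236067 2.236068 :=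
  ⟨Real.lt_sqrt_of_sq_lt (by norm_num), (Real.sqrt_lt' (by norm_num)).2 (by norm_num)⟩

lemma cot_pi_div_four : Real.cot (π / 4) = 1 := by
  rw [← Real.tan_inv_eq_cot, Real.tan_pi_div_four, inv_one]

lemma cot_pi_div_three_sq : Real.cot (π / 3) ^ 2 = 1 / 3 := by
  rw [← Real.tan_inv_eq_cot, Real.tan_pi_div_three, inv_pow, Real.sq_sqrt zero_le_three, one_div]

lemma cot_three_pi_div_ten : Real.cot (3 * π / 10) = Real.tan (π / 5) := by
  rw [← Real.tan_inv_eq_cot, show 3 * π / 10 = π / 2 - π / 5 by ring, Real.tan_pi_div_two_sub,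
    inv_inv]

lemma cot_three_pi_div_ten_sq : Real.cot (3 * π / 10) ^ 2 = 5 - 2 * √5 := by
  have hsqrt : √5 ^ 2 = 5 := Real.sq_sqrt (by norm_num)
  rw [cot_three_pi_div_ten, Real.tan_eq_sin_div_cos, div_pow, Real.sin_sq, Real.cos_pi_div_five,
    div_eq_iff (by positivity)]
  linear_combination (√5 - 1) / 8 * hsqrt

lemma cot_half_eq (x : ℝ) : Real.cot (x / 2) = (1 + Real.cos x) / Real.sin x := by
  nth_rw 2 3 [← mul_div_cancel₀ x (two_ne_zero' ℝ)]
  rw [Real.cos_two_mul, Real.sin_two_mul, Real.cot_eq_cos_div_sin]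
  rcases eq_or_ne (Real.cos (x / 2)) 0 with h | h
  · simp [h]
  · field_simp
    ring

lemma cot_seven_pi_div_twenty :
    Real.cot (7 * π / 20) = √5 - 1 - Real.cot (3 * π / 10) := by
  have hsqrt : √5 ^ 2 = 5 := Real.sq_sqrt (by norm_num)
  have hcos : (√5 - 1) * Real.cos (π / 5) = 1 := by
    rw [Real.cos_pi_div_five]
    linear_combination hsqrt / 4
  calc Real.cot (7 * π / 20) = Real.cot ((π / 5 + π / 2) / 2) := by ring_nf
    _ = (1 - Real.sin (π / 5)) / Real.cos (π / 5) := by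
        rw [cot_half_eq, Real.cos_add_pi_div_two, Real.sin_add_pi_div_two, sub_eq_add_neg]
    _ = √5 - 1 - Real.cot (3 * π / 10) := by
        rw [cot_three_pi_div_ten, Real.tan_eq_sin_div_cos, sub_div,
          eq_one_div_of_mul_eq_one_left hcos]

lemma cot_three_pi_div_ten_mem_Ioo : Real.cot (3 * π / 10) ∈ Set.Ioo 0.72654 0.72655 := by
  have hpos : 0 < Real.cot (3 * π / 10) :=
    cot_pos (by linarith [Real.pi_pos]) (by linarith [Real.pi_pos])
  have hsq := cot_three_pi_div_ten_sq
  have hsqrt := sqrt_five_mem_Ioo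
  constructor
  · refine lt_of_pow_lt_pow_left₀ 2 hpos.le ?_
    linarith [hsqrt.2]
  · refine lt_of_pow_lt_pow_left₀ 2 (by norm_num) ?_
    linarith [hsqrt.1]

lemma one_sub_le_cot_half {x : ℝ} (hx : x ∈ Set.Ioo 0 π) :
    1 - (x - π / 2) ≤ Real.cot (x / 2) := by
  have htangent := cot_half_tangent_le hx (c := π / 2)
    ⟨by linarith [Real.pi_pos], by linarith [Real.pi_pos]⟩
  rw [show π / 2 / 2 = π / 4 by ring, cot_pi_div_four] at htangent
  linarith

/- The tangent lines at the angles `2π/3` and `3π/5` of the regular hexagon and pentagon, with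
coefficients rounded so that the bounds stay valid. -/
lemma hexagonal_tangent_le_cot_half {x : ℝ} (hx : x ∈ Set.Ioo 0 π) :
    0.57735 - 2 / 3 * (x - 2 * π / 3) ≤ Real.cot (x / 2) := by
  have htangent := cot_half_tangent_le hx (c := 2 * π / 3)
    ⟨by linarith [Real.pi_pos], by linarith [Real.pi_pos]⟩
  rw [show 2 * π / 3 / 2 = π / 3 by ring, cot_pi_div_three_sq] at htangent
  have hcot : 0.57735 < Real.cot (π / 3) := by
    refine lt_of_pow_lt_pow_left₀ 2
      (cot_pos (by linarith [Real.pi_pos]) (by linarith [Real.pi_pos])).le ?_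
    rw [cot_pi_div_three_sq]
    norm_num
  linarith

lemma pentagonal_tangent_le_cot_half {x : ℝ} (hx : x ∈ Set.Ioo 0 π) :
    0.7262 - 0.764 * (x - 3 * π / 5) ≤ Real.cot (x / 2) := by
  have htangent := cot_half_tangent_le hx (c := 3 * π / 5)
    ⟨by linarith [Real.pi_pos], by linarith [Real.pi_pos]⟩
  rw [show 3 * π / 5 / 2 = 3 * π / 10 by ring, cot_three_pi_div_ten_sq] at htangent
  have hslope : |√5 - 2.236| ≤ 0.0001 := by
    rw [abs_le]
    constructor <;> linarith [sqrt_five_mem_Ioo.1, sqrt_five_mem_Ioo.2]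
  have hdist : |x - 3 * π / 5| ≤ 2 := by
    rw [abs_le]
    constructor <;> linarith [hx.1, hx.2, Real.pi_lt_d2, Real.pi_pos]
  have hround : |(√5 - 2.236) * (x - 3 * π / 5)| ≤ 0.0001 * 2 := by
    rw [abs_mul]
    gcongr
  linarith [(abs_le.1 hround).1, cot_three_pi_div_ten_mem_Ioo.1]

/-- The angles of the minimizing pentagon, in increasing order. -/
noncomputable def optimalAngle : Fin 5 → ℝ :=
  ![π / 2, 3 * π / 5, 3 * π / 5, 3 * π / 5, 7 * π / 10]

lemma optimalAngle_mem_Ioo (i : Fin 5) : optimalAngle i ∈ Set.Ioo 0 π := by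
  fin_cases i <;> simp only [optimalAngle] <;> constructor <;> norm_num <;> linarith [Real.pi_pos]

lemma sum_optimalAngle : ∑ i, optimalAngle i = 3 * π := by
  simp only [Fin.sum_univ_five, optimalAngle, Matrix.cons_val]
  ring

/-- The sum of the cotangents of the half-angles of the minimizing pentagon. By Lhuilier's
inequality it is a quarter of the square of the least perimeter. -/
noncomputable def minCotSum : ℝ := ∑ i, Real.cot (optimalAngle i / 2)

lemma minCotSum_eq : minCotSum = √5 + 2 * Real.cot (3 * π / 10) := by
  simp only [minCotSum, optimalAngle, Fin.sum_univ_five, Matrix.cons_val]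
  rw [show π / 2 / 2 = π / 4 by ring, show 3 * π / 5 / 2 = 3 * π / 10 by ring,
    show 7 * π / 10 / 2 = 7 * π / 20 by ring, cot_pi_div_four, cot_seven_pi_div_twenty]
  ring

lemma minCotSum_mem_Ioo : minCotSum ∈ Set.Ioo 3.68914 3.68917 := by
  have hsqrt := sqrt_five_mem_Ioo
  have hcot := cot_three_pi_div_ten_mem_Ioo
  rw [minCotSum_eq]
  constructor
  · linarith [hsqrt.1, hcot.1]
  · linarith [hsqrt.2, hcot.2]

section

variable {x : Fin 5 → ℝ}

lemma pi_div_two_lt_apply_one (hx : ∀ i, x i ∈ Set.Ioo 0 π) (hmono : Monotone x)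
    (hsum : ∑ i, x i = 3 * π) (hcot : ∑ i, Real.cot (x i / 2) < 3.69) : π / 2 < x 1 := by
  by_contra! hle
  have h01 : x 0 ≤ x 1 := hmono (Fin.zero_le 1)
  rw [Fin.sum_univ_five] at hsum hcot
  linarith [one_sub_le_cot_half (hx 0), one_sub_le_cot_half (hx 1),
    hexagonal_tangent_le_cot_half (hx 2), hexagonal_tangent_le_cot_half (hx 3),
    hexagonal_tangent_le_cot_half (hx 4)]

lemma two_pi_lt_three_mul_add (hx : ∀ i, x i ∈ Set.Ioo 0 π) (hmono : Monotone x)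
    (hsum : ∑ i, x i = 3 * π) (hcot : ∑ i, Real.cot (x i / 2) < 3.69) :
    2 * π < 3 * x 0 + x 1 := by
  by_contra! hle
  have hx1 := pi_div_two_lt_apply_one hx hmono hsum hcot
  rw [Fin.sum_univ_five] at hsum hcot
  linarith [one_sub_le_cot_half (hx 0), pentagonal_tangent_le_cot_half (hx 1),
    hexagonal_tangent_le_cot_half (hx 2), hexagonal_tangent_le_cot_half (hx 3),
    hexagonal_tangent_le_cot_half (hx 4), Real.pi_gt_d4]

lemma apply_zero_eq_of_angleTilesDegreeFour {j : Fin 5} (hmono : Monotone x)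
    (hlt : 2 * π < 3 * x 0 + x 1) (hfour : AngleTilesDegreeFour x j) : x 0 = π / 2 := by
  obtain ⟨m, -, hcard, hm⟩ := hfour
  rw [Fin.sum_univ_five] at hcard hm
  have hcast : (m 0 + m 1 + m 2 + m 3 + m 4 : ℝ) * x 1 = 4 * x 1 :=
    congrArg (· * x 1) (mod_cast hcard)
  have hle : ∀ i, 1 ≤ i → (m i : ℝ) * x 1 ≤ m i * x i := fun i hi ↦
    mul_le_mul_of_nonneg_left (hmono hi) (Nat.cast_nonneg _)
  have hbound : (m 0 : ℝ) * x 0 + (4 - m 0) * x 1 ≤ 2 * π := by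
    linarith [hle 2 (by decide), hle 3 (by decide), hle 4 (by decide)]
  have hm0 : m 0 = 4 := by
    by_contra! h
    have hm0_le : (m 0 : ℝ) ≤ 3 := mod_cast (by lia : m 0 ≤ 3)
    have h01 : x 0 ≤ x 1 := hmono (Fin.zero_le 1)
    linarith [mul_nonneg (sub_nonneg.2 hm0_le) (sub_nonneg.2 h01)]
  have hrest : m 1 = 0 ∧ m 2 = 0 ∧ m 3 = 0 ∧ m 4 = 0 := by lia
  simp only [hm0, hrest, Nat.cast_ofNat, Nat.cast_zero, zero_mul, add_zero] at hm
  linarith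

lemma two_pi_le_add_two_mul_of_angleTiles (hmono : Monotone x) (hx0 : x 0 = π / 2)
    (hx1 : π / 2 < x 1) (htile : AngleTiles x 1) : 2 * π ≤ x 1 + 2 * x 4 := by
  obtain ⟨n, hn, hnx⟩ := htile
  have hcard_lt : ((∑ i, n i : ℕ) : ℝ) < 4 := by
    refine lt_of_mul_lt_mul_right (a := π / 2) ?_ (by positivity)
    calc (∑ i, n i : ℕ) * (π / 2) = ∑ i, (n i : ℝ) * (π / 2) := by
          rw [Nat.cast_sum, Finset.sum_mul]
      _ < ∑ i, (n i : ℝ) * x i :=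
          Finset.sum_lt_sum
            (fun i _ ↦ mul_le_mul_of_nonneg_left (hx0 ▸ hmono (Fin.zero_le i)) (Nat.cast_nonneg _))
            ⟨1, Finset.mem_univ 1, mul_lt_mul_of_pos_left hx1 (Nat.cast_pos.2 hn)⟩
      _ = 4 * (π / 2) := by
          rw [hnx]
          ring
  have hcard : ∑ i, n i ≤ 3 := Nat.lt_succ_iff.1 (mod_cast hcard_lt)
  have hcast : (n 0 + n 1 + n 2 + n 3 + n 4 : ℝ) ≤ 3 :=
    mod_cast (Fin.sum_univ_five n).symm.trans_le hcard
  have hle : ∀ i, (n i : ℝ) * x i ≤ n i * x 4 := fun i ↦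
    mul_le_mul_of_nonneg_left (hmono (Fin.le_last i)) (Nat.cast_nonneg _)
  have h14 : x 1 ≤ x 4 := hmono (Fin.le_last 1)
  have hone : (n 1 - 1 : ℝ) * x 1 ≤ (n 1 - 1) * x 4 :=
    mul_le_mul_of_nonneg_left h14 (sub_nonneg.2 (Nat.one_le_cast.2 hn))
  have hthree : (n 0 + n 1 + n 2 + n 3 + n 4) * x 4 ≤ 3 * x 4 :=
    mul_le_mul_of_nonneg_right hcast (by linarith [Real.pi_pos])
  rw [Fin.sum_univ_five] at hnx
  linarith [hle 0, hle 2, hle 3, hle 4]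

lemma seven_pi_div_ten_le_apply_four (hmono : Monotone x) (hsum : ∑ i, x i = 3 * π)
    (hx0 : x 0 = π / 2) (hx1 : π / 2 < x 1) (htile : AngleTiles x 1) : 7 * π / 10 ≤ x 4 := by
  have htwo := two_pi_le_add_two_mul_of_angleTiles hmono hx0 hx1 htile
  have h12 : x 1 ≤ x 2 := hmono (by decide)
  have h13 : x 1 ≤ x 3 := hmono (by decide)
  rw [Fin.sum_univ_five] at hsum
  linarith

lemma minCotSum_lt_of_seven_pi_div_ten_le (hx : ∀ i, x i ∈ Set.Ioo 0 π)
    (hsum : ∑ i, x i = 3 * π) (hx0 : x 0 = π / 2) (hx4 : 7 * π / 10 ≤ x 4)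
    (hne : x ≠ optimalAngle) : minCotSum < ∑ i, Real.cot (x i / 2) := by
  refine sum_lt_sum_of_strictConvexOn (f := fun y ↦ Real.cot (y / 2))
    (f' := fun y ↦ -(1 + Real.cot (y / 2) ^ 2) / 2)
    strictConvexOn_cot_half (fun i ↦ hasDerivAt_cot_half (optimalAngle_mem_Ioo i)) hx
    optimalAngle_mem_Ioo hne ?_
  have hcot : Real.cot (7 * π / 10 / 2) < Real.cot (3 * π / 5 / 2) :=
    cot_lt_cot (by linarith [Real.pi_pos]) (by linarith [Real.pi_pos]) (by linarith [Real.pi_pos])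
  have hpos : 0 < Real.cot (7 * π / 10 / 2) :=
    cot_pos (by linarith [Real.pi_pos]) (by linarith [Real.pi_pos])
  have hgap : 0 ≤ (Real.cot (3 * π / 5 / 2) ^ 2 - Real.cot (7 * π / 10 / 2) ^ 2) *
      (x 4 - 7 * π / 10) :=
    mul_nonneg (sub_nonneg.2 (pow_le_pow_left₀ hpos.le hcot.le 2)) (sub_nonneg.2 hx4)
  rw [Fin.sum_univ_five] at hsum
  simp only [Fin.sum_univ_five, optimalAngle, Matrix.cons_val, hx0, sub_self, mul_zero, zero_add]
  have hlin : x 1 + x 2 + x 3 - 9 * π / 5 = -(x 4 - 7 * π / 10) := by linarith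
  linear_combination hgap / 2 +
    (1 + Real.cot (3 * π / 5 / 2) ^ 2) / 2 * hlin

lemma minCotSum_lt {j : Fin 5} (hx : ∀ i, x i ∈ Set.Ioo 0 π) (hmono : Monotone x)
    (hsum : ∑ i, x i = 3 * π) (htile : AngleTiles x 1) (hfour : AngleTilesDegreeFour x j)
    (hne : x ≠ optimalAngle) : minCotSum < ∑ i, Real.cot (x i / 2) := by
  by_contra! hle
  have hcot : ∑ i, Real.cot (x i / 2) < 3.69 := by linarith [minCotSum_mem_Ioo.2]
  have hx0 := apply_zero_eq_of_angleTilesDegreeFour hmono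
    (two_pi_lt_three_mul_add hx hmono hsum hcot) hfour
  have hx4 := seven_pi_div_ten_le_apply_four hmono hsum hx0
    (pi_div_two_lt_apply_one hx hmono hsum hcot) htile
  exact (minCotSum_lt_of_seven_pi_div_ten_le hx hsum hx0 hx4 hne).not_ge hle

end

lemma exists_eq_comp_perm_of_map_univ_eq {n : ℕ} {α : Type*} [LinearOrder α] {f g : Fin n → α}
    (h : Multiset.map f Finset.univ.val = Multiset.map g Finset.univ.val) :
    ∃ σ : Equiv.Perm (Fin n), f = g ∘ σ := by
  rw [Fin.univ_val_map, Fin.univ_val_map, Multiset.coe_eq_coe] at h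
  have hperm : (List.ofFn (f ∘ Tuple.sort f)).Perm (List.ofFn (g ∘ Tuple.sort g)) :=
    ((Equiv.Perm.ofFn_comp_perm _ f).trans h).trans (Equiv.Perm.ofFn_comp_perm _ g).symm
  have hsorted : f ∘ Tuple.sort f = g ∘ Tuple.sort g :=
    List.ofFn_injective (hperm.eq_of_sortedLE (Tuple.monotone_sort f).sortedLE_ofFn
      (Tuple.monotone_sort g).sortedLE_ofFn)
  refine ⟨Tuple.sort g * (Tuple.sort f)⁻¹, ?_⟩
  ext i
  simpa using congrFun hsorted ((Tuple.sort f)⁻¹ i)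

lemma AngleTiles.comp_perm {a : Fin 5 → ℝ} {σ : Equiv.Perm (Fin 5)} {j : Fin 5}
    (h : AngleTiles a (σ j)) : AngleTiles (a ∘ σ) j := by
  obtain ⟨m, hj, hm⟩ := h
  exact ⟨m ∘ σ, hj, (Equiv.sum_comp σ fun i ↦ (m i : ℝ) * a i).trans hm⟩

lemma AngleTilesDegreeFour.comp_perm {a : Fin 5 → ℝ} {σ : Equiv.Perm (Fin 5)} {j : Fin 5}
    (h : AngleTilesDegreeFour a (σ j)) : AngleTilesDegreeFour (a ∘ σ) j := by
  obtain ⟨m, hj, hcard, hm⟩ := h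
  exact ⟨m ∘ σ, hj, (Equiv.sum_comp σ m).trans hcard,
    (Equiv.sum_comp σ fun i ↦ (m i : ℝ) * a i).trans hm⟩

lemma angleTilesDegreeFour_optimalAngle_zero : AngleTilesDegreeFour optimalAngle 0 := by
  refine ⟨![4, 0, 0, 0, 0], by decide, by decide, ?_⟩
  simp only [Fin.sum_univ_five, optimalAngle, Matrix.cons_val]
  ring

lemma angleTiles_optimalAngle (j : Fin 5) : AngleTiles optimalAngle j := by
  have htile : ∀ m : Fin 5 → ℕ, 0 < m j →
      (5 * m 0 + 6 * (m 1 + m 2 + m 3) + 7 * m 4 = 20) → AngleTiles optimalAngle j := by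
    intro m hj hm
    have hm' : (5 * m 0 + 6 * (m 1 + m 2 + m 3) + 7 * m 4 : ℝ) = 20 := mod_cast hm
    refine ⟨m, hj, ?_⟩
    simp only [Fin.sum_univ_five, optimalAngle, Matrix.cons_val]
    linear_combination π / 10 * hm'
  fin_cases j
  · exact htile ![4, 0, 0, 0, 0] (by decide) (by decide)
  · exact htile ![0, 1, 0, 0, 2] (by decide) (by decide)
  · exact htile ![0, 0, 1, 0, 2] (by decide) (by decide)
  · exact htile ![0, 0, 0, 1, 2] (by decide) (by decide)
  · exact htile ![0, 1, 0, 0, 2] (by decide) (by decide)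

lemma minCotSum_lt_of_forall_ne_comp_perm {a : Fin 5 → ℝ} (ha : ∀ i, a i ∈ Set.Ioo 0 π)
    (hsum : ∑ i, a i = 3 * π) (htiles : ∀ j, AngleTiles a j) (hfour : ∃ j, AngleTilesDegreeFour a j)
    (hne : ∀ σ : Equiv.Perm (Fin 5), a ≠ optimalAngle ∘ σ) :
    minCotSum < ∑ i, Real.cot (a i / 2) := by
  set σ := Tuple.sort a
  obtain ⟨j, hj⟩ := hfour
  rw [← Equiv.sum_comp σ fun i ↦ Real.cot (a i / 2)]
  refine minCotSum_lt (j := σ⁻¹ j) (fun i ↦ ha (σ i)) (Tuple.monotone_sort a)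
    ((Equiv.sum_comp σ a).trans hsum) (htiles (σ 1)).comp_perm
    (AngleTilesDegreeFour.comp_perm (by simpa using hj)) fun h ↦ hne σ⁻¹ ?_
  rw [← h]
  ext i
  simp

/-- The angles of the pentagon are, in some order, those of the minimizing pentagon. -/
def HasOptimalAngles (P : Polygon ℂ 5) : Prop :=
  ∃ σ : Equiv.Perm (Fin 5), interiorAngle P = optimalAngle ∘ σ

lemma hasOptimalAngles_iff {P : Polygon ℂ 5} :
    HasOptimalAngles P ↔ Multiset.map (interiorAngle P) Finset.univ.val =
      {π / 2, 3 * π / 5, 3 * π / 5, 3 * π / 5, 7 * π / 10} := by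
  change _ ↔ _ = Multiset.map optimalAngle Finset.univ.val
  refine ⟨?_, exists_eq_comp_perm_of_map_univ_eq⟩
  rintro ⟨σ, hσ⟩
  rw [hσ, ← Multiset.map_map, Multiset.map_univ_val_equiv]

namespace HasOptimalAngles

variable {P : Polygon ℂ 5}

lemma locallyConvex (h : HasOptimalAngles P) : LocallyConvex P := by
  obtain ⟨σ, hσ⟩ := h
  rw [locallyConvex_iff, hσ]
  exact fun i ↦ optimalAngle_mem_Ioo (σ i)

lemma sum_interiorAngle (h : HasOptimalAngles P) : ∑ i, interiorAngle P i = 3 * π := by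
  obtain ⟨σ, hσ⟩ := h
  rw [hσ]
  exact (Equiv.sum_comp σ optimalAngle).trans sum_optimalAngle

lemma sum_cotHalf (h : HasOptimalAngles P) : ∑ i, cotHalf P i = minCotSum := by
  obtain ⟨σ, hσ⟩ := h
  simp only [cotHalf, hσ]
  exact Equiv.sum_comp σ fun i ↦ Real.cot (optimalAngle i / 2)

lemma isCompetitor (h : HasOptimalAngles P) (hP : IsUnitPentagon P) : IsCompetitor P := by
  obtain ⟨σ, hσ⟩ := h
  refine ⟨hP, fun j ↦ ?_, σ⁻¹ 0, ?_⟩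
  · rw [hσ]
    exact (angleTiles_optimalAngle (σ j)).comp_perm
  · rw [hσ]
    exact AngleTilesDegreeFour.comp_perm (by simpa using angleTilesDegreeFour_optimalAngle_zero)

lemma perimeter_sq_eq (h : HasOptimalAngles P) (hP : IsUnitPentagon P) (hc : IsCircumscribed P) :
    perimeter P ^ 2 = 4 * minCotSum := by
  rw [← (h.locallyConvex.four_mul_signedArea_mul_sum_cotHalf_eq_iff h.sum_interiorAngle).2 hc,
    hP.area, h.sum_cotHalf, mul_one]

end HasOptimalAngles

lemma IsCompetitor.four_mul_minCotSum_lt {P : Polygon ℂ 5} (hP : IsCompetitor P)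
    (h : ¬(IsCircumscribed P ∧ HasOptimalAngles P)) : 4 * minCotSum < perimeter P ^ 2 := by
  by_cases hconv : LocallyConvex P
  · have hsum := hconv.sum_interiorAngle hP.simple
    have hlhuilier := hconv.lhuilier hsum
    have heq := hconv.four_mul_signedArea_mul_sum_cotHalf_eq_iff hsum
    rw [hP.area, mul_one] at hlhuilier heq
    by_cases hopt : HasOptimalAngles P
    · rw [hopt.sum_cotHalf] at hlhuilier heq
      exact hlhuilier.lt_of_ne fun e ↦ h ⟨heq.1 e, hopt⟩
    · have hlt : minCotSum < ∑ i, cotHalf P i :=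
        minCotSum_lt_of_forall_ne_comp_perm (locallyConvex_iff.1 hconv) hsum hP.tiles
          hP.tiles_four (not_exists.1 hopt)
      linarith
  · obtain ⟨k, hk⟩ : ∃ k, orient (P k) (P (k + 1)) (P (k + 2)) ≤ 0 := by
      simpa [LocallyConvex] using hconv
    have := sixteen_mul_signedArea_le_perimeter_sq hk
    rw [hP.area] at this
    linarith [minCotSum_mem_Ioo.2]

lemma perimeter_nonneg (P : Polygon ℂ 5) : 0 ≤ perimeter P :=
  Finset.sum_nonneg fun _ _ ↦ dist_nonneg

lemma exists_isCircumscribed_hasOptimalAngles :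
    ∃ P : Polygon ℂ 5, IsUnitPentagon P ∧ IsCircumscribed P ∧ HasOptimalAngles P := by
  obtain ⟨P, hP, hc, ha⟩ := exists_isCircumscribed_of_sum_eq optimalAngle_mem_Ioo sum_optimalAngle
  exact ⟨P, hP, hc, 1, ha⟩

theorem isPerimeterMinimizer_iff {P : Polygon ℂ 5} :
    IsPerimeterMinimizer P ↔ IsUnitPentagon P ∧ IsCircumscribed P ∧ HasOptimalAngles P := by
  constructor
  · intro h
    refine ⟨h.toIsUnitPentagon, ?_⟩
    by_contra hnot
    obtain ⟨Q, hQ, hQc, hQa⟩ := exists_isCircumscribed_hasOptimalAngles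
    have hlt : perimeter Q ^ 2 < perimeter P ^ 2 :=
      (hQa.perimeter_sq_eq hQ hQc).trans_lt (h.toIsCompetitor.four_mul_minCotSum_lt hnot)
    exact (lt_of_pow_lt_pow_left₀ 2 (perimeter_nonneg P) hlt).not_ge
      (h.le_perimeter Q (hQa.isCompetitor hQ))
  · rintro ⟨hP, hc, ha⟩
    refine ⟨ha.isCompetitor hP, fun Q hQ ↦ le_of_sq_le_sq ?_ (perimeter_nonneg Q)⟩
    rw [ha.perimeter_sq_eq hP hc]
    by_cases hQopt : IsCircumscribed Q ∧ HasOptimalAngles Q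
    · exact (hQopt.2.perimeter_sq_eq hQ.toIsUnitPentagon hQopt.1).ge
    · exact (hQ.four_mul_minCotSum_lt hQopt).le

lemma IsPerimeterMinimizer.abs_perimeter_sub_lt {P : Polygon ℂ 5} (h : IsPerimeterMinimizer P) :
    |perimeter P - 3.8414| < 0.00005 := by
  obtain ⟨hP, hc, ha⟩ := isPerimeterMinimizer_iff.1 h
  have hsq := ha.perimeter_sq_eq hP hc
  have hlower : 3.84135 < perimeter P := by
    refine lt_of_pow_lt_pow_left₀ 2 (perimeter_nonneg P) ?_
    linarith [minCotSum_mem_Ioo.1]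
  have hupper : perimeter P < 3.84145 := by
    refine lt_of_pow_lt_pow_left₀ 2 (by norm_num) ?_
    linarith [minCotSum_mem_Ioo.2]
  rw [abs_lt]
  constructor <;> linarith

end PentagonTiling

open PentagonTiling in
theorem proposition2p15 :
    (∃ P : Polygon ℂ 5, IsPerimeterMinimizer P) ∧
    (∀ P : Polygon ℂ 5, IsPerimeterMinimizer P ↔
      IsUnitPentagon P ∧ IsCircumscribed P ∧
        Multiset.map (interiorAngle P) Finset.univ.val =
          {Real.pi / 2, 3 * Real.pi / 5, 3 * Real.pi / 5, 3 * Real.pi / 5, 7 * Real.pi / 10}) ∧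
    (∀ P : Polygon ℂ 5, IsPerimeterMinimizer P → |perimeter P - 3.8414| < 0.00005) := by
  refine ⟨?_, fun P ↦ ?_, fun P h ↦ h.abs_perimeter_sub_lt⟩
  · obtain ⟨P, hP⟩ := exists_isCircumscribed_hasOptimalAngles
    exact ⟨P, isPerimeterMinimizer_iff.2 hP⟩
  · rw [isPerimeterMinimizer_iff, hasOptimalAngles_iff]
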